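/- **Theorem 7.3.** Let $G$ be a finite abelian group, $\widehat G=\mathrm{Hom}(G,\mathbb C^\times)$, and $n$ a positive integer. For a set $A$, an $A$-composition of $n$ is a tuple $p=((a_1,x_1),\dots,(a_k,x_k))$ with $|p|=(a_1,\dots,a_k)$ a composition of $n$ and $x_i\in A$; put $\ell(p)=k$. An $A$-partition of $n$ is a multiset of such pairs, with $\ell$ its number of elements; $\mathrm{supp}(p)$ is the $A$-partition obtained from $p$ by forgetting the order. Let $\Gamma_n[A]$ and $\Lambda_n[A]$ be the sets of $A$-compositions and $A$-partitions of $n$. For $p,q\in\Gamma_n[G]$ write $p\le q$ if $|q|$ refines $|p|$ and every block of $q$ has the same label as the block of $p$ it refines; in that case $\deg(q/p)$ is the product, over the blocks of $p$, of the number of blocks of $q$ refining that block. For $\alpha=((a_i,\alpha_i))_i\in\Gamma_n[\widehat G]$ and $p=((a_i,g_i))_i\in\Gamma_n[G]$ with $|p|=|\alpha|$, let $\alpha(p)=\prod_i\alpha_i(g_i)$. Let $\mathfrak S_n[G]$ be the wreath product: the set $\mathfrak S_n\times G^n$ with the product $((\sigma_i,g_i))_i\cdot((\tau_i,h_i))_i=((\sigma_{\tau_i},g_{\tau_i}h_i))_i$.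 For $(\sigma,g)\in\mathfrak S_n[G]$ let $\mathrm{co}(\sigma,g)\in\Gamma_n[G]$ be the coarsest ($\le$-smallest) $G$-composition of $n$ such that on each of its blocks of consecutive positions $\sigma$ is increasing and $g$ is constant, equal to the label of the block. In $\mathbb C\mathfrak S_n[G]$ define, for $p\in\Gamma_n[G]$, $$Y_p=\sum_{\mathrm{co}(\sigma,g)=p}(\sigma,g),\qquad X_p=\sum_{q\le p}Y_q .$$ Then the linear span $\mathsf{MR}_n[G]$ of the elements $Y_p$ is a (unital) subalgebra of $\mathbb C\mathfrak S_n[G]$, the Mantaci–Reutenauer algebra, and the elements $$\mathfrak f_\lambda=\frac{1}{|G|^{\ell(\lambda)}\,\ell(\lambda)!}\sum_{\substack{\alpha\in\Gamma_n[\widehat G]\\ \mathrm{supp}(\alpha)=\lambda}}\ \sum_{\substack{p\in\Gamma_n[G]\\ |p|=|\alpha|}}\overline{\alpha(p)}\sum_{\substack{q\in\Gamma_n[G]\\ p\le q}}\frac{(-1)^{\ell(q)-\ell(p)}}{\deg(q/p)}\,X_q,\qquad \lambda\in\Lambda_n[\widehat G],$$ lie in $\mathsf{MR}_n[G]$ and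 form a complete system of primitive orthogonal idempotents of it: $\mathfrak f_\lambda\mathfrak f_\mu=\delta_{\lambda\mu}\mathfrak f_\lambda$, $\sum_\lambda\mathfrak f_\lambda=1$, and each $\mathfrak f_\lambda$ is nonzero and is not the sum of two nonzero idempotents $e_1,e_2\in\mathsf{MR}_n[G]$ with $e_1e_2=e_2e_1=0$. -/

import Mathlib

open scoped BigOperators

/-! ## Compositions and partitions of `n` colored by a set `A` -/

/-- An `A`-composition of the integer `n`: a tuple `((a₁, x₁), …, (a_k, x_k))` where
`(a₁, …, a_k)` is a composition of `n` and `x_i ∈ A`.  The field `comp` is the underlying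
composition `|p|`, and `comp.length` is the number of blocks `ℓ(p)`. -/
structure ColoredComposition (A : Type*) (n : ℕ) where
  comp : Composition n
  label : Fin comp.length → A

/-- An `A`-partition of the integer `n`: a multiset of pairs `(a, x)` with `a` a positive integer
and `x ∈ A`, such that the integers sum to `n`. -/
@[ext]
structure ColoredPartition (A : Type*) (n : ℕ) where
  parts : Multiset (ℕ × A)
  parts_pos : ∀ x ∈ parts, 0 < x.1
  parts_sum : (parts.map Prod.fst).sum = n

namespace ColoredComposition

variable {A : Type*} {n : ℕ}

/-- The label of the block of `p` that contains the position `i` of `{0, …, n - 1}`. -/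
def labelAt (p : ColoredComposition A n) (i : Fin n) : A :=
  p.label (p.comp.index i)

/-- `p ≤ q` if `q` is a label-preserving refinement of `p`: the blocks of `q` refine those of `p`,
and each block of `q` carries the label of the block of `p` that it refines. -/
instance : LE (ColoredComposition A n) where
  le p q := p.comp.boundaries ⊆ q.comp.boundaries ∧ ∀ i : Fin n, p.labelAt i = q.labelAt i

/-- The support: forget the order of the blocks. -/
def supp (p : ColoredComposition A n) : ColoredPartition A n where
  parts := (Finset.univ : Finset (Fin p.comp.length)).val.map
    fun i => (p.comp.blocksFun i, p.label i)
  parts_pos := by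
    intro x hx
    obtain ⟨i, -, rfl⟩ := Multiset.mem_map.1 hx
    exact p.comp.one_le_blocksFun i
  parts_sum := by
    rw [Multiset.map_map]
    exact p.comp.sum_blocksFun

theorem supp_surjective : Function.Surjective (supp : ColoredComposition A n → _) := by
  intro lam
  let l : List (ℕ × A) := lam.parts.toList
  have hl : (l : Multiset (ℕ × A)) = lam.parts := Multiset.coe_toList _
  let c : Composition n :=
    { blocks := l.map Prod.fst
      blocks_pos := by
        intro i hi
        obtain ⟨x, hx, rfl⟩ := List.mem_map.1 hi
        exact lam.parts_pos x (Multiset.mem_toList.1 hx)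
      blocks_sum := by
        have h := lam.parts_sum
        rw [← hl] at h
        simpa using h }
  have hc : c.length = l.length := by
    change (l.map Prod.fst).length = l.length
    simp
  refine ⟨⟨c, fun i => (l.get (Fin.cast hc i)).2⟩, ?_⟩
  ext1
  rw [← hl]
  change (Finset.univ : Finset (Fin c.length)).val.map _ = _
  rw [Fin.univ_val_map]
  congr 1
  apply List.ext_getElem
  · simpa using hc
  · intro i h1 h2
    simp [Composition.blocksFun, c]

noncomputable instance [Finite A] : Fintype (ColoredComposition A n) :=
  have : Finite (ColoredComposition A n) :=
    Finite.of_injective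
      (fun p => (⟨p.comp, p.label⟩ : Σ c : Composition n, Fin c.length → A))
      (by rintro ⟨c, f⟩ ⟨d, g⟩ h; cases h; rfl)
  Fintype.ofFinite _

end ColoredComposition

noncomputable instance {A : Type*} {n : ℕ} [Finite A] : Fintype (ColoredPartition A n) :=
  have : Finite (ColoredPartition A n) := Finite.of_surjective _ ColoredComposition.supp_surjective
  Fintype.ofFinite _

/-- `deg(q/p) = ∏ᵢ ℓ((q/p)ᵢ)` for compositions `p`, `q` of `n` with `q` refining `p`, where
`ℓ((q/p)ᵢ)` is the number of blocks of `q` contained in the `i`-th block of `p`. -/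
def Composition.deg {n : ℕ} (q p : Composition n) : ℕ :=
  ∏ i : Fin p.length,
    (Finset.univ.filter fun j : Fin q.length =>
      ∀ k : Fin (q.blocksFun j), p.index (q.embedding j k) = i).card

/-! ## The wreath product and its Mantaci–Reutenauer algebra -/

/-- The wreath product `𝔖_n[G]`, with underlying set `𝔖_n × Gⁿ`: its elements
`((σ₁, g₁), …, (σ_n, g_n))` are written in one-line notation. -/
@[ext]
structure ColoredPerm (G : Type*) (n : ℕ) where
  perm : Equiv.Perm (Fin n)
  color : Fin n → G

namespace ColoredPerm

variable {G : Type*} {n : ℕ}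

instance [Finite G] : Finite (ColoredPerm G n) :=
  Finite.of_injective (fun w => (w.perm, w.color)) (by
    rintro ⟨s, g⟩ ⟨t, h⟩ e
    cases e
    rfl)

noncomputable instance [Finite G] : Fintype (ColoredPerm G n) :=
  Fintype.ofFinite _

variable [Group G]

/-- `((σ_i, g_i))_i * ((τ_i, h_i))_i = ((σ_{τ_i}, g_{τ_i} h_i))_i`. -/
instance : Mul (ColoredPerm G n) where
  mul v w := ⟨v.perm * w.perm, fun i => v.color (w.perm i) * w.color i⟩

instance : One (ColoredPerm G n) where
  one := ⟨1, fun _ => 1⟩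

instance : Inv (ColoredPerm G n) where
  inv w := ⟨w.perm⁻¹, fun i => (w.color (w.perm⁻¹ i))⁻¹⟩

theorem mul_def (v w : ColoredPerm G n) :
    v * w = ⟨v.perm * w.perm, fun i => v.color (w.perm i) * w.color i⟩ := rfl

theorem one_def : (1 : ColoredPerm G n) = ⟨1, fun _ => 1⟩ := rfl

theorem inv_def (w : ColoredPerm G n) :
    w⁻¹ = ⟨w.perm⁻¹, fun i => (w.color (w.perm⁻¹ i))⁻¹⟩ := rfl

instance : Group (ColoredPerm G n) :=
  Group.ofLeftAxioms
    (by intro a b c; simp [mul_def, mul_assoc])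
    (by intro a; simp [mul_def, one_def])
    (by intro a; simp [mul_def, one_def, inv_def])

end ColoredPerm

namespace MantaciReutenauer

/-- The group algebra `ℂ 𝔖_n[G]`. -/
abbrev GroupAlg (G : Type*) [Group G] (n : ℕ) : Type _ := MonoidAlgebra ℂ (ColoredPerm G n)

/-- On each block of `p`, the one-line notation of `σ` is increasing and all the `g_i` are equal
to the label of the block. -/
def IsCompatible {G : Type*} {n : ℕ} (p : ColoredComposition G n) (w : ColoredPerm G n) : Prop :=
  ∀ j : Fin p.comp.length,
    StrictMono (fun k : Fin (p.comp.blocksFun j) => w.perm (p.comp.embedding j k)) ∧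
    ∀ k : Fin (p.comp.blocksFun j), w.color (p.comp.embedding j k) = p.label j

/-- `co(σ, g) = p`: among the `G`-compositions compatible with `(σ, g)`, `p` is the coarsest. -/
def IsCo {G : Type*} {n : ℕ} (w : ColoredPerm G n) (p : ColoredComposition G n) : Prop :=
  IsCompatible p w ∧ ∀ q : ColoredComposition G n, IsCompatible q w → p ≤ q

variable {G : Type*} {n : ℕ}

open scoped Classical in
/-- `Y_p`, the sum of all `(σ, g)` with `co(σ, g) = p`. -/
noncomputable def Y [Group G] [Finite G] (p : ColoredComposition G n) : GroupAlg G n :=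
  ∑ w : ColoredPerm G n with IsCo w p, MonoidAlgebra.of ℂ (ColoredPerm G n) w

open scoped Classical in
/-- `X_p = ∑_{q ≤ p} Y_q`. -/
noncomputable def X [Group G] [Finite G] (p : ColoredComposition G n) : GroupAlg G n :=
  ∑ q : ColoredComposition G n with q ≤ p, Y q

/-- The subspace `MR_n[G]` of `ℂ 𝔖_n[G]`, spanned by the `Y_p`. -/
noncomputable def mrSubmodule (G : Type*) [Group G] [Finite G] (n : ℕ) :
    Submodule ℂ (GroupAlg G n) :=
  Submodule.span ℂ (Set.range (Y : ColoredComposition G n → GroupAlg G n))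

/-- The evaluation `α(p) = ∏ᵢ αᵢ(pᵢ)` of a `Ĝ`-composition on a `G`-composition with the same
underlying composition (and `0` if the underlying compositions differ). -/
noncomputable def evalChar [CommGroup G] (α : ColoredComposition (G →* ℂˣ) n)
    (p : ColoredComposition G n) : ℂ :=
  if h : p.comp = α.comp then
    ∏ i : Fin α.comp.length,
      ((α.label i (p.label (Fin.cast (congrArg Composition.length h.symm) i)) : ℂˣ) : ℂ)
  else 0

open scoped Classical in
/-- The element `𝔣_λ` of `ℂ 𝔖_n[G]`. -/
noncomputable def idem [CommGroup G] [Finite G] (lam : ColoredPartition (G →* ℂˣ) n) :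
    GroupAlg G n :=
  (1 / ((Nat.card G : ℂ) ^ lam.parts.card * (lam.parts.card.factorial : ℂ))) •
    ∑ α : ColoredComposition (G →* ℂˣ) n with α.supp = lam,
      ∑ p : ColoredComposition G n with p.comp = α.comp,
        starRingEnd ℂ (evalChar α p) •
          ∑ q : ColoredComposition G n with p ≤ q,
            ((-1 : ℂ) ^ ((q.comp.length : ℤ) - (p.comp.length : ℤ)) /
              (q.comp.deg p.comp : ℂ)) • X q

end MantaciReutenauer

/-! ## Complete systems of primitive orthogonal idempotents -/

/-- A primitive idempotent: a nonzero idempotent that is not the sum of two nonzero idempotents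
`e₁`, `e₂` with `e₁ e₂ = 0 = e₂ e₁`. -/
structure IsPrimitiveIdempotent {R : Type*} [Ring R] (e : R) : Prop where
  idem : IsIdempotentElem e
  ne_zero : e ≠ 0
  indecomposable : ∀ e₁ e₂ : R, IsIdempotentElem e₁ → IsIdempotentElem e₂ →
    e₁ * e₂ = 0 → e₂ * e₁ = 0 → e = e₁ + e₂ → e₁ = 0 ∨ e₂ = 0

/-- A complete system of primitive orthogonal idempotents. -/
structure IsCSoPOI {R I : Type*} [Ring R] [Fintype I] (e : I → R) : Prop where
  complete_orthogonal : CompleteOrthogonalIdempotents e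
  primitive : ∀ i, IsPrimitiveIdempotent (e i)

/-!
The proof transports the statement to the algebra of ordered set partitions of `{0, …, n - 1}` whose
blocks are labelled by elements of `G`. These "faces" are encoded as total preorders with a coloring
constant on the classes; they form a submonoid of the monoid `ColoredRel` of all colored relations,
with the lexicographic product. By the argument of Bidigare and Hsiao, the invariants of the
symmetric group in the face algebra are anti-isomorphic to the Mantaci–Reutenauer algebra: they act
from the left on the span of the chambers, which is the regular representation of the wreath
product, and this action commutes with left multiplication in the wreath product because `G` is
commutative (`toChambers_mul`). The sum of the permutations of an interval face goes to a multiple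
of some `X p` (`toChambers_toGroupAlg`, `exists_toGroupAlg_eq_X`), so the span of the `X p`, which
is the span of the `Y p`, is a subalgebra.

In the face algebra, let `eulerian x` be the product of the first Eulerian idempotents
`∑ (-1)^(ℓ - 1)/ℓ • y` of the blocks of an ordered set partition `x`, and let `isotypic x α` be its
component for the character `α` of the group of labellings of `x`. The following facts drive the
proof.

* A face whose blocks properly refine `x` annihilates `eulerian x`
  (`face_mul_eulerian_eq_zero`); as in the proof that the first Eulerian idempotent is a Lie
  element, a product of two binomial coefficients has no linear term.
* Summing over all orders of the blocks makes `isotypic x α` vanish under left multiplication by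
  any `isotypic x' α'` with a different number of blocks (`isotypic_mul_sum_perm_eq_zero`), and for
  the same number of blocks the product is zero unless the labelled set partitions agree up to the
  order of the blocks (`isotypic_mul_isotypic`).

So if `relIdem lam` is the sum of the `isotypic x α` of type `lam`, divided by the number of orders
of the blocks, then `isotypic x α * relIdem lam` is `isotypic x α` or zero according to the type of
`(x, α)` (`isotypic_mul_relIdem`). This gives orthogonality. As the `isotypic x α` span the face
algebra by a triangularity argument (`δ_mem_isotypicSpan`), it also gives completeness, and shows
that the left ideal of `relIdem lam` is spanned by the `isotypic x α` of type `lam`. These are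
permuted transitively by the symmetric groups of the ground set and of the blocks, so the corner of
the invariants at `relIdem lam` consists of scalars (`exists_smul_of_corner`), which is primitivity.
Comparing the coefficients of interval faces identifies the image of `relIdem lam` with `idem lam`
(`toGroupAlg_relIdem`).

All these computations use one device: the coefficients of the Eulerian idempotents are linear
coefficients in `t` of the number of functions to `{0, …, t - 1}` with a given order pattern. Taking
the linear coefficient is encoded by the finite weights `linWeight`.
-/

/-! ### A weight extracting the linear coefficient of a polynomial -/

namespace MantaciReutenauer

/-- Weights `κ₀, …, κ_n` such that `∑ₛ κₛ P(s)` is the linear coefficient of every polynomial `P` of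
degree at most `n`: the linear coefficients of the Lagrange basis at the nodes `0, …, n`. -/
noncomputable def linWeight (n s : ℕ) : ℂ :=
  (Lagrange.basis (Finset.range (n + 1)) (fun i : ℕ => (i : ℂ)) s).coeff 1

theorem sum_linWeight (n : ℕ) (P : Polynomial ℂ) (hP : P.natDegree ≤ n) :
    ∑ s ∈ Finset.range (n + 1), linWeight n s * P.eval (s : ℂ) = P.coeff 1 := by
  have hdeg : P.degree < (Finset.range (n + 1)).card := by
    rw [Finset.card_range]
    exact lt_of_le_of_lt Polynomial.degree_le_natDegree (by exact_mod_cast Nat.lt_succ_of_le hP)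
  have h := Lagrange.eq_interpolate (s := Finset.range (n + 1)) (v := fun i : ℕ => (i : ℂ))
    (f := P) (fun a _ b _ hab => by simpa using hab) hdeg
  conv_rhs => rw [h]
  rw [Lagrange.interpolate_apply, Polynomial.finsetSum_coeff]
  refine Finset.sum_congr rfl fun s _ => ?_
  rw [Polynomial.coeff_C_mul, mul_comm, linWeight]

theorem sum_linWeight_mul_pow {n m : ℕ} (hm : m ≤ n) :
    ∑ s ∈ Finset.range (n + 1), linWeight n s * (s : ℂ) ^ m = if m = 1 then 1 else 0 := by
  have h := sum_linWeight n (Polynomial.X ^ m) (by simpa using hm)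
  simpa [Polynomial.coeff_X_pow, eq_comm] using h

/-- The polynomial whose value at `s : ℕ` is `s.choose m`. -/
noncomputable def choosePoly (m : ℕ) : Polynomial ℂ :=
  Polynomial.C ((m.factorial : ℂ)⁻¹) * descPochhammer ℂ m

theorem eval_choosePoly (m s : ℕ) : (choosePoly m).eval (s : ℂ) = (s.choose m : ℂ) := by
  have h : (m.factorial : ℂ) ≠ 0 := by exact_mod_cast m.factorial_ne_zero
  rw [choosePoly, Polynomial.eval_mul, Polynomial.eval_C, descPochhammer_eval_eq_descFactorial,
    Nat.descFactorial_eq_factorial_mul_choose]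
  push_cast
  field_simp

theorem natDegree_choosePoly_le (m : ℕ) : (choosePoly m).natDegree ≤ m :=
  (Polynomial.natDegree_C_mul_le _ _).trans (descPochhammer_natDegree ℂ m).le

theorem X_dvd_choosePoly {m : ℕ} (hm : m ≠ 0) : Polynomial.X ∣ choosePoly m := by
  rw [Polynomial.X_dvd_iff, Polynomial.coeff_zero_eq_eval_zero, choosePoly, Polynomial.eval_mul,
    descPochhammer_ne_zero_eval_zero ℂ hm, mul_zero]

theorem coeff_one_choosePoly (m : ℕ) :
    (choosePoly (m + 1)).coeff 1 = (-1) ^ m / ((m + 1 : ℕ) : ℂ) := by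
  have h : (m.factorial : ℂ) ≠ 0 := by exact_mod_cast m.factorial_ne_zero
  have h' : ((m + 1 : ℕ) : ℂ) ≠ 0 := by exact_mod_cast m.succ_ne_zero
  have key : ∀ j : ℕ, (descPochhammer ℂ j).eval (-1) = (-1) ^ j * (j.factorial : ℂ) := by
    intro j
    induction j with
    | zero => simp
    | succ j ih =>
      rw [descPochhammer_succ_eval, ih, Nat.factorial_succ]
      push_cast
      ring
  rw [choosePoly, Polynomial.coeff_C_mul, descPochhammer_succ_left, Polynomial.coeff_X_mul,
    Polynomial.coeff_zero_eq_eval_zero, Polynomial.eval_comp, Polynomial.eval_sub,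
    Polynomial.eval_X, Polynomial.eval_one, zero_sub, key, Nat.factorial_succ]
  push_cast at h' ⊢
  field_simp

/-- The coefficients of `log (1 + z)` are the linear coefficients in `s` of those of `(1 + z) ^ s`.
-/
theorem sum_linWeight_mul_choose {n m : ℕ} (hm : m ≠ 0) (hmn : m ≤ n) :
    ∑ s ∈ Finset.range (n + 1), linWeight n s * (s.choose m : ℂ) = (-1) ^ (m - 1) / (m : ℂ) := by
  obtain ⟨m, rfl⟩ := Nat.exists_eq_succ_of_ne_zero hm
  rw [Nat.succ_eq_add_one, Nat.add_sub_cancel, ← coeff_one_choosePoly,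
    ← sum_linWeight n _ ((natDegree_choosePoly_le _).trans hmn)]
  exact Finset.sum_congr rfl fun s _ => by rw [eval_choosePoly]

/-- A product of at least two binomial coefficients of positive lower index has no linear term. -/
theorem sum_linWeight_mul_prod_choose {n : ℕ} {J : Type*} [DecidableEq J] (S : Finset J)
    (m : J → ℕ) (hm : ∀ j ∈ S, m j ≠ 0) (hmn : ∑ j ∈ S, m j ≤ n) {a b : J} (ha : a ∈ S)
    (hb : b ∈ S) (hab : a ≠ b) :
    ∑ s ∈ Finset.range (n + 1), linWeight n s * ∏ j ∈ S, (s.choose (m j) : ℂ) = 0 := by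
  have hdeg : (∏ j ∈ S, choosePoly (m j)).natDegree ≤ n :=
    (Polynomial.natDegree_prod_le _ _).trans
      ((Finset.sum_le_sum fun j _ => natDegree_choosePoly_le (m j)).trans hmn)
  have h := sum_linWeight n _ hdeg
  have hdvd : Polynomial.X ^ 2 ∣ ∏ j ∈ S, choosePoly (m j) := by
    rw [← Finset.mul_prod_erase S _ ha,
      ← Finset.mul_prod_erase (S.erase a) _ (Finset.mem_erase.2 ⟨hab.symm, hb⟩), ← mul_assoc,
      pow_two]
    exact Dvd.dvd.mul_right
      (mul_dvd_mul (X_dvd_choosePoly (hm a ha)) (X_dvd_choosePoly (hm b hb))) _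
  rw [Polynomial.X_pow_dvd_iff.1 hdvd 1 one_lt_two] at h
  rw [← h]
  refine Finset.sum_congr rfl fun s _ => ?_
  rw [Polynomial.eval_prod]
  simp_rw [eval_choosePoly]

/-! ### Counting functions with a prescribed order pattern -/

/-- Functions `D → {0, …, t - 1}` with the same order pattern as `h₀` correspond to the subsets of
`{0, …, t - 1}` of cardinality `#(image of h₀)`, by taking the image. -/
theorem card_pattern {D : Type*} [Fintype D] [DecidableEq D] (h₀ : D → ℕ) (t : ℕ) :
    ((Fintype.piFinset fun _ : D => Finset.range t).filter
      fun h => ∀ v v', h v ≤ h v' ↔ h₀ v ≤ h₀ v').card =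
      t.choose (Finset.univ.image h₀).card := by
  classical
  set A := Finset.univ.image h₀ with hA
  have hmem : ∀ v, h₀ v ∈ A := fun v => Finset.mem_image_of_mem _ (Finset.mem_univ v)
  let r : D → Fin A.card := fun v => (A.orderIsoOfFin rfl).symm ⟨h₀ v, hmem v⟩
  have hr : ∀ v v', r v ≤ r v' ↔ h₀ v ≤ h₀ v' := by
    intro v v'
    simp only [r, OrderIso.le_iff_le, Subtype.mk_le_mk]
  have hrs : Function.Surjective r := by
    intro i
    obtain ⟨v, -, hv⟩ := Finset.mem_image.1 ((A.orderIsoOfFin rfl) i).2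
    refine ⟨v, ?_⟩
    simp only [r]
    rw [OrderIso.symm_apply_eq]
    exact Subtype.ext hv
  rw [← Finset.card_range t, ← Finset.card_powersetCard, Finset.card_range]
  have hfac : ∀ h : D → ℕ, (∀ v v', h v ≤ h v' ↔ h₀ v ≤ h₀ v') →
      ∃ φ : Fin A.card → ℕ, StrictMono φ ∧ h = φ ∘ r := by
    intro h hh
    choose s hs using hrs
    refine ⟨fun i => h (s i), ?_, ?_⟩
    · intro i j hij
      rw [lt_iff_not_ge] at hij ⊢
      rw [hh, ← hr, hs, hs]
      exact hij
    · funext v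
      have e : r (s (r v)) = r v := hs _
      apply le_antisymm <;> simp only [Function.comp_apply] <;> rw [hh, ← hr, e]
  have himg : ∀ φ : Fin A.card → ℕ, Finset.univ.image (φ ∘ r) = Finset.univ.image φ := by
    intro φ
    rw [← Finset.image_image, Finset.image_univ_of_surjective hrs]
  refine Finset.card_bij (fun h _ => Finset.univ.image h) ?_ ?_ ?_
  · intro h hh
    rw [Finset.mem_filter, Fintype.mem_piFinset] at hh
    obtain ⟨φ, hφ, rfl⟩ := hfac h hh.2
    rw [Finset.mem_powersetCard, himg]
    refine ⟨?_, ?_⟩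
    · rw [← himg]
      intro a ha
      obtain ⟨v, -, rfl⟩ := Finset.mem_image.1 ha
      exact hh.1 v
    · rw [Finset.card_image_of_injective _ hφ.injective, Finset.card_univ, Fintype.card_fin]
  · intro h hh h' hh' e
    obtain ⟨φ, hφ, rfl⟩ := hfac h (Finset.mem_filter.1 hh).2
    obtain ⟨φ', hφ', rfl⟩ := hfac h' (Finset.mem_filter.1 hh').2
    simp only [himg] at e
    have hc : (Finset.univ.image φ).card = A.card := by
      rw [Finset.card_image_of_injective _ hφ.injective, Finset.card_univ, Fintype.card_fin]
    have h1 := Finset.orderEmbOfFin_unique hc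
      (fun x => Finset.mem_image_of_mem _ (Finset.mem_univ x)) hφ
    have h2 := Finset.orderEmbOfFin_unique hc
      (fun x => e ▸ Finset.mem_image_of_mem _ (Finset.mem_univ x)) hφ'
    have h12 : φ = φ' := h1.trans h2.symm
    rw [h12]
  · intro S hS
    rw [Finset.mem_powersetCard] at hS
    refine ⟨S.orderEmbOfFin hS.2 ∘ r, ?_, ?_⟩
    · rw [Finset.mem_filter, Fintype.mem_piFinset]
      refine ⟨fun v => hS.1 (Finset.orderEmbOfFin_mem _ _ _), fun v v' => ?_⟩
      simp only [Function.comp_apply, OrderEmbedding.le_iff_le, hr]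
    · rw [himg, Finset.image_orderEmbOfFin_univ]

/-- The fiberwise version of `card_pattern`: only values at points of the same fiber of `p` are
compared. -/
theorem card_pattern_fiberwise {V J : Type*} [Fintype V] [DecidableEq V] [Fintype J]
    [DecidableEq J] (p : V → J) (h₀ : V → ℕ) (t : J → ℕ) :
    ((Fintype.piFinset fun v : V => Finset.range (t (p v))).filter
      fun h => ∀ v v', p v = p v' → (h v ≤ h v' ↔ h₀ v ≤ h₀ v')).card =
      ∏ j, (t j).choose ((Finset.univ.filter fun v => p v = j).image h₀).card := by
  classical
  have e : ∀ j, ((Finset.univ.filter fun v => p v = j).image h₀) =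
      (Finset.univ.image fun v : {v // p v = j} => h₀ v) := by
    intro j
    ext a
    simp
  simp_rw [e, ← card_pattern]
  rw [← Fintype.card_piFinset]
  refine Finset.card_bij (fun h _ j v => h v.1) ?_ ?_ ?_
  · intro h hh
    rw [Finset.mem_filter, Fintype.mem_piFinset] at hh
    rw [Fintype.mem_piFinset]
    intro j
    rw [Finset.mem_filter, Fintype.mem_piFinset]
    refine ⟨fun v => ?_, fun v v' => hh.2 _ _ (v.2.trans v'.2.symm)⟩
    have := hh.1 v.1
    rwa [v.2] at this
  · intro h _ h' _ e
    funext v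
    exact congrFun (congrFun e (p v)) ⟨v, rfl⟩
  · intro k hk
    rw [Fintype.mem_piFinset] at hk
    have hk1 : ∀ j, (∀ v, k j v ∈ Finset.range (t j)) ∧
        ∀ v v', k j v ≤ k j v' ↔ h₀ v ≤ h₀ v' := by
      intro j
      have := hk j
      rwa [Finset.mem_filter, Fintype.mem_piFinset] at this
    refine ⟨fun v => k (p v) ⟨v, rfl⟩, ?_, ?_⟩
    · rw [Finset.mem_filter, Fintype.mem_piFinset]
      refine ⟨fun v => (hk1 _).1 _, fun v v' hv => ?_⟩
      have : k (p v') ⟨v', rfl⟩ = k (p v) ⟨v', hv.symm⟩ := by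
        have : ∀ j (hj : p v' = j), k (p v') ⟨v', rfl⟩ = k j ⟨v', hj⟩ := by
          intro j hj
          subst hj
          rfl
        exact this _ hv.symm
      simp only [this]
      exact (hk1 (p v)).2 _ _
    · funext j v
      obtain ⟨v, rfl⟩ := v
      rfl

end MantaciReutenauer

/-! ### The monoid of colored relations -/

namespace MantaciReutenauer

/-- A binary relation on `V` together with a `G`-coloring of `V`.  The total preorders whose classes
are monochromatic are the ordered set partitions of `V` with blocks labelled by `G`; the product
below restricts to the usual (lexicographic) product of ordered set partitions. -/
@[ext]
structure ColoredRel (V G : Type*) where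
  le : V → V → Prop
  color : V → G

namespace ColoredRel

variable {V K G P : Type*}

instance [Finite V] [Finite G] : Finite (ColoredRel V G) :=
  Finite.of_injective (fun y => (y.le, y.color)) (by
    rintro ⟨a, b⟩ ⟨c, d⟩ h
    cases h
    rfl)

noncomputable instance [Finite V] [Finite G] : Fintype (ColoredRel V G) :=
  Fintype.ofFinite _

theorem ext_iff' {a b : ColoredRel V G} :
    a = b ↔ (∀ i j, a.le i j ↔ b.le i j) ∧ ∀ i, a.color i = b.color i := by
  constructor
  · rintro rfl
    exact ⟨fun _ _ => Iff.rfl, fun _ => rfl⟩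
  · rintro ⟨h, h'⟩
    exact ColoredRel.ext (funext fun i => funext fun j => propext (h i j)) (funext h')

/-- The relation `f i ≤ f j`, with the coloring `c`. -/
def ofFun [LE P] (f : V → P) (c : V → G) : ColoredRel V G := ⟨fun i j => f i ≤ f j, c⟩

/-- The total preorders with monochromatic classes, i.e. the ordered set partitions with blocks
labelled by `G`. -/
structure IsFace (y : ColoredRel V G) : Prop where
  total : ∀ i j, y.le i j ∨ y.le j i
  trans : ∀ i j k, y.le i j → y.le j k → y.le i k
  color_eq : ∀ i j, y.le i j → y.le j i → y.color i = y.color j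

theorem isFace_ofFun [LinearOrder P] {f : V → P} {c : V → G} (h : ∀ i j, f i = f j → c i = c j) :
    (ofFun f c).IsFace :=
  ⟨fun _ _ => le_total _ _, fun _ _ _ => le_trans, fun i j h1 h2 => h i j (le_antisymm h1 h2)⟩

/-- Every face is given by a surjection onto some `Fin k` together with labels of the `k` blocks. -/
theorem IsFace.exists_ofFun [Fintype V] {y : ColoredRel V G} (hy : y.IsFace) :
    ∃ (k : ℕ) (f : V → Fin k) (c : Fin k → G), Function.Surjective f ∧ y = ofFun f (c ∘ f) := by
  classical
  let f₀ : V → ℕ := fun i => (Finset.univ.filter fun j => ¬ y.le i j).card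
  have h₀ : ∀ i j, y.le i j ↔ f₀ i ≤ f₀ j := by
    intro i j
    constructor
    · intro h
      refine Finset.card_le_card fun l hl => ?_
      rw [Finset.mem_filter] at hl ⊢
      exact ⟨hl.1, fun h' => hl.2 (hy.trans _ _ _ h h')⟩
    · intro h
      by_contra hij
      have hji := (hy.total i j).resolve_left hij
      refine absurd h (not_le.2 (Finset.card_lt_card ?_))
      refine (Finset.ssubset_iff_of_subset fun l hl => ?_).2 ⟨j, ?_, ?_⟩
      · rw [Finset.mem_filter] at hl ⊢
        exact ⟨hl.1, fun h' => hl.2 (hy.trans _ _ _ hji h')⟩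
      · exact Finset.mem_filter.2 ⟨Finset.mem_univ _, hij⟩
      · intro hj
        rcases hy.total j j with h' | h' <;> exact (Finset.mem_filter.1 hj).2 h'
  let A := Finset.univ.image f₀
  have hmem : ∀ v, f₀ v ∈ A := fun v => Finset.mem_image_of_mem _ (Finset.mem_univ v)
  let f : V → Fin A.card := fun v => (A.orderIsoOfFin rfl).symm ⟨f₀ v, hmem v⟩
  have hf : ∀ v v', f v ≤ f v' ↔ f₀ v ≤ f₀ v' := by
    intro v v'
    simp only [f, OrderIso.le_iff_le, Subtype.mk_le_mk]
  have hfs : Function.Surjective f := by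
    intro i
    obtain ⟨v, -, hv⟩ := Finset.mem_image.1 ((A.orderIsoOfFin rfl) i).2
    refine ⟨v, ?_⟩
    simp only [f]
    rw [OrderIso.symm_apply_eq]
    exact Subtype.ext hv
  choose s hs using hfs
  refine ⟨A.card, f, fun i => y.color (s i), fun i => ⟨s i, hs i⟩, ?_⟩
  refine ext_iff'.2 ⟨fun i j => (h₀ i j).trans (hf i j).symm, fun i => ?_⟩
  have e : f (s (f i)) = f i := hs _
  exact hy.color_eq _ _ ((h₀ _ _).2 ((hf _ _).1 e.ge)) ((h₀ _ _).2 ((hf _ _).1 e.le))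

variable [Monoid G]

instance : Mul (ColoredRel V G) where
  mul a b := ⟨fun i j => a.le i j ∧ (a.le j i → b.le i j), fun i => a.color i * b.color i⟩

instance : One (ColoredRel V G) where
  one := ⟨fun _ _ => True, fun _ => 1⟩

theorem mul_le (a b : ColoredRel V G) (i j : V) :
    (a * b).le i j ↔ a.le i j ∧ (a.le j i → b.le i j) := Iff.rfl

theorem mul_color (a b : ColoredRel V G) (i : V) : (a * b).color i = a.color i * b.color i := rfl

theorem one_le (i j : V) : (1 : ColoredRel V G).le i j ↔ True := Iff.rfl

theorem one_color (i : V) : (1 : ColoredRel V G).color i = 1 := rfl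

instance : Monoid (ColoredRel V G) where
  mul_assoc a b c := by
    refine ext_iff'.2 ⟨fun i j => ?_, fun i => by simp only [mul_color, mul_assoc]⟩
    simp only [mul_le]
    tauto
  one_mul a := by
    refine ext_iff'.2 ⟨fun i j => ?_, fun i => by simp only [mul_color, one_color, one_mul]⟩
    simp only [mul_le, one_le]
    tauto
  mul_one a := by
    refine ext_iff'.2 ⟨fun i j => ?_, fun i => by simp only [mul_color, one_color, mul_one]⟩
    simp only [mul_le, one_le]
    tauto

/-- The pullback of a colored relation. -/
def comap (x : V → K) : ColoredRel K G →* ColoredRel V G where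
  toFun y := ⟨fun i j => y.le (x i) (x j), y.color ∘ x⟩
  map_one' := rfl
  map_mul' _ _ := rfl

theorem comap_le (x : V → K) (y : ColoredRel K G) (i j : V) :
    (comap x y).le i j ↔ y.le (x i) (x j) := Iff.rfl

theorem comap_color (x : V → K) (y : ColoredRel K G) (i : V) :
    (comap x y).color i = y.color (x i) := rfl

theorem comap_ofFun [LE P] (x : V → K) (f : K → P) (c : K → G) :
    comap x (ofFun f c) = ofFun (f ∘ x) (c ∘ x) := rfl

theorem isFace_one : IsFace (1 : ColoredRel V G) :=
  ⟨fun _ _ => Or.inl trivial, fun _ _ _ _ _ => trivial, fun _ _ _ _ => rfl⟩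

theorem IsFace.mul {a b : ColoredRel V G} (ha : a.IsFace) (hb : b.IsFace) : (a * b).IsFace where
  total i j := by
    simp only [mul_le]
    have := ha.total i j
    have := hb.total i j
    tauto
  trans i j k := by
    simp only [mul_le]
    rintro ⟨h1, h2⟩ ⟨h3, h4⟩
    refine ⟨ha.trans _ _ _ h1 h3, fun h => ?_⟩
    exact hb.trans _ _ _ (h2 (ha.trans _ _ _ h3 h)) (h4 (ha.trans _ _ _ h h1))
  color_eq i j := by
    simp only [mul_le, mul_color]
    rintro ⟨h1, h2⟩ ⟨h3, h4⟩
    rw [ha.color_eq _ _ h1 h3, hb.color_eq _ _ (h2 h3) (h4 h1)]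

theorem IsFace.comap {y : ColoredRel K G} (hy : y.IsFace) (x : V → K) : (comap x y).IsFace :=
  ⟨fun _ _ => hy.total _ _, fun _ _ _ => hy.trans _ _ _, fun _ _ => hy.color_eq _ _⟩

theorem ofFun_mul_ofFun_eq_iff [PartialOrder P] {f : V → P} {c : V → G} {h h' : V → ℕ} :
    ofFun f c * ofFun h 1 = ofFun f c * ofFun h' 1 ↔
      ∀ i j, f i = f j → (h i ≤ h j ↔ h' i ≤ h' j) := by
  rw [ext_iff']
  constructor
  · rintro ⟨h1, -⟩ i j hij
    have := h1 i j
    simpa only [mul_le, ofFun, hij, le_refl, true_and, forall_const] using this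
  · intro h1
    refine ⟨fun i j => ?_, fun i => rfl⟩
    simp only [mul_le, ofFun]
    refine and_congr_right fun hij => imp_congr_right fun hji => ?_
    exact h1 _ _ (le_antisymm hij hji)

end ColoredRel

open ColoredRel

/-- The algebra of the monoid of colored relations. -/
abbrev RelAlg (V G : Type*) [Monoid G] : Type _ := MonoidAlgebra ℂ (ColoredRel V G)

/-- The basis element of the algebra attached to a colored relation. -/
noncomputable abbrev δ {V G : Type*} [Monoid G] : ColoredRel V G →* RelAlg V G :=
  MonoidAlgebra.of ℂ (ColoredRel V G)

open scoped Classical in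
theorem coeff_δ {V G : Type*} [Monoid G] (y z : ColoredRel V G) :
    (δ y).coeff z = if y = z then 1 else 0 := by
  rw [δ, MonoidAlgebra.of_apply, MonoidAlgebra.coeff_single, Finsupp.single_apply]

/-- For `x : Fin n → Fin k`, the product of the first Eulerian idempotents
`∑ (-1)^(ℓ(y) - 1)/ℓ(y) y` (`y` an ordered partition of the block) of the blocks of `x`.  The
coefficients are encoded as the linear coefficients in `t` of the sums over all functions from the
block to `{0, …, t - 1}`. -/
noncomputable def eulerian {G : Type*} [Monoid G] {n k : ℕ} (x : Fin n → Fin k) :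
    RelAlg (Fin n) G :=
  ∑ t ∈ Fintype.piFinset fun _ : Fin k => Finset.range (n + 1), (∏ i, linWeight n (t i)) •
    ∑ h ∈ Fintype.piFinset fun v => Finset.range (t (x v)), δ (ofFun h 1)

section

variable {G : Type*} [Monoid G] {n k m : ℕ}

theorem mul_eulerian (a : RelAlg (Fin n) G) (x : Fin n → Fin k) :
    a * eulerian x = ∑ t ∈ Fintype.piFinset fun _ : Fin k => Finset.range (n + 1),
      (∏ i, linWeight n (t i)) •
        ∑ h ∈ Fintype.piFinset fun v => Finset.range (t (x v)), a * δ (ofFun h 1) := by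
  simp only [eulerian, Finset.mul_sum, mul_smul_comm]

/-- A product over `i` of sums over `s`, expanded with the weights of `eulerian`. -/
theorem sum_weight_mul_prod (u : Fin m → Fin k) (a : Fin m → ℕ → ℂ) :
    ∑ t ∈ Fintype.piFinset fun _ : Fin k => Finset.range (n + 1),
      (∏ i, linWeight n (t i)) * ∏ j, a j (t (u j)) =
    ∏ i, ∑ s ∈ Finset.range (n + 1),
      linWeight n s * ∏ j ∈ Finset.univ.filter (fun j => u j = i), a j s := by
  rw [Finset.prod_univ_sum]
  refine Finset.sum_congr rfl fun t _ => ?_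
  rw [Finset.prod_mul_distrib]
  congr 1
  rw [← Finset.prod_fiberwise Finset.univ u]
  refine Finset.prod_congr rfl fun i _ => Finset.prod_congr rfl fun j hj => ?_
  rw [(Finset.mem_filter.1 hj).2]

/-- The coefficient in `ofFun f c * eulerian x` of a face refining `f`, when `f` refines `x`: the
functions contributing to it are counted by products of binomial coefficients. -/
theorem coeff_mul_eulerian (f : Fin n → Fin m) (c : Fin n → G) (u : Fin m → Fin k)
    (h₀ : Fin n → ℕ) :
    (δ (ofFun f c) * eulerian (u ∘ f)).coeff (ofFun f c * ofFun h₀ 1) =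
      ∏ i, ∑ s ∈ Finset.range (n + 1), linWeight n s *
        ∏ j ∈ Finset.univ.filter (fun j => u j = i),
          (s.choose ((Finset.univ.filter fun v => f v = j).image h₀).card : ℂ) := by
  classical
  rw [mul_eulerian, ← sum_weight_mul_prod u
    (fun j s => (s.choose ((Finset.univ.filter fun v => f v = j).image h₀).card : ℂ)),
    MonoidAlgebra.coeff_sum, Finsupp.finsetSum_apply]
  refine Finset.sum_congr rfl fun t _ => ?_
  rw [MonoidAlgebra.coeff_smul_apply, smul_eq_mul, MonoidAlgebra.coeff_sum,
    Finsupp.finsetSum_apply]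
  congr 1
  have h := card_pattern_fiberwise f h₀ (fun j => t (u j))
  rw [← Nat.cast_prod, ← h, Finset.card_filter, Nat.cast_sum]
  refine Finset.sum_congr rfl fun h _ => ?_
  rw [← map_mul, coeff_δ, Nat.cast_ite, Nat.cast_one, Nat.cast_zero]
  simp only [ofFun_mul_ofFun_eq_iff]
  congr

/-- An ordered set partition which splits a block of `x` annihilates the Eulerian idempotents of
`x`: this is the statement that the first Eulerian idempotent is a Lie element. -/
theorem ofFun_mul_eulerian_eq_zero {f : Fin n → Fin m} (hf : Function.Surjective f)
    (c : Fin n → G) {u : Fin m → Fin k} (hu : ¬ Function.Injective u) :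
    δ (ofFun f c) * eulerian (u ∘ f) = 0 := by
  classical
  obtain ⟨a, b, hab, hne⟩ : ∃ a b, u a = u b ∧ a ≠ b := by
    simpa only [Function.Injective, not_forall, exists_prop] using hu
  ext R
  by_cases hR : ∃ h₀ : Fin n → ℕ, ofFun f c * ofFun h₀ 1 = R
  · obtain ⟨h₀, rfl⟩ := hR
    rw [coeff_mul_eulerian]
    refine Finset.prod_eq_zero (Finset.mem_univ (u a)) ?_
    refine sum_linWeight_mul_prod_choose _ _ (fun j _ => ?_) ?_
      (Finset.mem_filter.2 ⟨Finset.mem_univ a, rfl⟩)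
      (Finset.mem_filter.2 ⟨Finset.mem_univ b, hab.symm⟩) hne
    · obtain ⟨v, hv⟩ := hf j
      exact Finset.card_ne_zero_of_mem
        (Finset.mem_image_of_mem _ (Finset.mem_filter.2 ⟨Finset.mem_univ v, hv⟩))
    · calc _ ≤ ∑ j : Fin m, ((Finset.univ.filter fun v => f v = j).image h₀).card :=
            Finset.sum_le_sum_of_subset (Finset.filter_subset _ _)
        _ ≤ ∑ j : Fin m, (Finset.univ.filter fun v => f v = j).card :=
            Finset.sum_le_sum fun j _ => Finset.card_image_le
        _ = n := by
            rw [← Finset.card_eq_sum_card_fiberwise fun v _ =>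
              Finset.mem_coe.2 (Finset.mem_univ (f v)), Finset.card_univ, Fintype.card_fin]
  · push Not at hR
    rw [mul_eulerian, MonoidAlgebra.coeff_sum, Finsupp.finsetSum_apply, MonoidAlgebra.coeff_zero,
      Finsupp.zero_apply]
    refine Finset.sum_eq_zero fun t _ => ?_
    rw [MonoidAlgebra.coeff_smul_apply, MonoidAlgebra.coeff_sum, Finsupp.finsetSum_apply,
      Finset.sum_eq_zero, smul_zero]
    intro h _
    rw [← map_mul, coeff_δ, if_neg (hR h)]

/-- The version of `ofFun_mul_eulerian_eq_zero` for a face whose blocks refine those of `x`. -/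
theorem face_mul_eulerian_eq_zero {y : ColoredRel (Fin n) G} (hy : y.IsFace) {x : Fin n → Fin k}
    (hyx : ∀ i j, y.le i j → y.le j i → x i = x j) {i j : Fin n} (hij : x i = x j)
    (hij' : ¬ (y.le i j ∧ y.le j i)) : δ y * eulerian x = 0 := by
  obtain ⟨m, f, c, hf, rfl⟩ := hy.exists_ofFun
  choose s hs using hf
  have hx : x = (x ∘ s) ∘ f := by
    funext v
    exact hyx _ _ (hs (f v)).ge (hs (f v)).le
  rw [hx]
  refine ofFun_mul_eulerian_eq_zero (fun j => ⟨s j, hs j⟩) _ fun hinj => hij' ?_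
  rw [hx] at hij
  have : f i = f j := hinj hij
  exact ⟨this.le, this.ge⟩

/-- `eulerian` does not depend on the order of the blocks. -/
theorem eulerian_perm_comp (u : Equiv.Perm (Fin k)) (x : Fin n → Fin k) :
    (eulerian (u ∘ x) : RelAlg (Fin n) G) = eulerian x := by
  rw [eulerian, eulerian]
  refine Finset.sum_bij (fun t _ => t ∘ u) ?_ ?_ ?_ ?_
  · intro t ht
    rw [Fintype.mem_piFinset] at ht ⊢
    exact fun i => ht (u i)
  · intro t _ t' _ h
    exact u.surjective.injective_comp_right h
  · intro t ht
    refine ⟨t ∘ u.symm, ?_, ?_⟩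
    · rw [Fintype.mem_piFinset] at ht ⊢
      exact fun i => ht (u.symm i)
    · funext i
      simp
  · intro t _
    rw [← Equiv.prod_comp u]
    rfl

end

end MantaciReutenauer

/-! ### Symmetrization -/

namespace MantaciReutenauer

open ColoredRel

/-- Sorting by `u` and breaking the ties by an injective map `q`. -/
theorem exists_perm_lex {k : ℕ} {P₀ P : Type*} [LinearOrder P₀] [LinearOrder P] (u : Fin k → P₀)
    {q : Fin k → P} (hq : Function.Injective q) :
    ∃ σ : Equiv.Perm (Fin k), Monotone (u ∘ σ) ∧
      ∀ i j, toLex (u i, q i) ≤ toLex (u j, q j) ↔ σ.symm i ≤ σ.symm j := by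
  let f : Fin k → P₀ ×ₗ P := fun i => toLex (u i, q i)
  have hf : Function.Injective f := fun i j h => hq (congrArg Prod.snd (toLex.injective h))
  have hs : StrictMono (f ∘ Tuple.sort f) :=
    (Tuple.monotone_sort f).strictMono_of_injective (hf.comp (Tuple.sort f).injective)
  refine ⟨Tuple.sort f, fun i j h => ?_, fun i j => ?_⟩
  · exact Prod.Lex.monotone_fst _ _ (Tuple.monotone_sort f h)
  · have := hs.le_iff_le (a := (Tuple.sort f).symm i) (b := (Tuple.sort f).symm j)
    simpa only [Function.comp_apply, Equiv.apply_symm_apply] using this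

/-- An injective map `q` breaks the ties of `u : Fin k → Fin m`; all tie-breakings are
related by permutations preserving `u`. -/
theorem sum_stabilizer_lex_eq {A : Type*} [AddCommMonoid A] {k m : ℕ} (u : Fin k → Fin m)
    (F : (Fin k → Fin k → Prop) → A) {P P' : Type*} [LinearOrder P] [LinearOrder P']
    {q : Fin k → P} {q' : Fin k → P'} (hq : Function.Injective q) (hq' : Function.Injective q') :
    ∑ τ : Equiv.Perm (Fin k) with ∀ i, u (τ i) = u i,
      F (fun i j => toLex (u (τ i), q (τ i)) ≤ toLex (u (τ j), q (τ j))) =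
    ∑ τ : Equiv.Perm (Fin k) with ∀ i, u (τ i) = u i,
      F (fun i j => toLex (u (τ i), q' (τ i)) ≤ toLex (u (τ j), q' (τ j))) := by
  obtain ⟨σ, hσ, h⟩ := exists_perm_lex u hq
  obtain ⟨σ', hσ', h'⟩ := exists_perm_lex u hq'
  have e : ∀ i, u (σ i) = u (σ' i) := congrFun (Tuple.unique_monotone hσ hσ')
  simp_rw [h, h']
  refine Finset.sum_bij' (fun τ _ => σ' * σ⁻¹ * τ) (fun τ _ => σ * σ'⁻¹ * τ) ?_ ?_ ?_ ?_ ?_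
  · intro τ hτ
    rw [Finset.mem_filter] at hτ ⊢
    refine ⟨Finset.mem_univ _, ?_⟩
    intro i
    rw [← hτ.2 i]
    simp only [Equiv.Perm.mul_apply, ← e]
    exact congrArg u (σ.apply_symm_apply _)
  · intro τ hτ
    rw [Finset.mem_filter] at hτ ⊢
    refine ⟨Finset.mem_univ _, ?_⟩
    intro i
    rw [← hτ.2 i]
    simp only [Equiv.Perm.mul_apply, e]
    exact congrArg u (σ'.apply_symm_apply _)
  · intro τ _
    group
  · intro τ _
    group
  · intro τ _
    have : ∀ i, σ'.symm ((σ' * σ⁻¹ * τ) i) = σ.symm (τ i) := by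
      intro i
      simp [Equiv.Perm.mul_apply]
    simp_rw [this]

/-- Breaking ties uniformly at random after refining by all functions `s` with `s i < t (u i)` gives
the same result as breaking ties uniformly at random. -/
theorem sum_lex_perm {A : Type*} [AddCommGroup A] [Module ℂ A] {k m : ℕ} (u : Fin k → Fin m)
    (t : Fin m → ℕ) (F : (Fin k → Fin k → Prop) → A) :
    ∑ s ∈ Fintype.piFinset fun i => Finset.range (t (u i)), ∑ π : Equiv.Perm (Fin k),
      F (fun i j => toLex (u i, toLex (s i, π i)) ≤ toLex (u j, toLex (s j, π j))) =
    (∏ i, (t (u i) : ℂ)) • ∑ π : Equiv.Perm (Fin k),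
      F (fun i j => toLex (u i, π i) ≤ toLex (u j, π j)) := by
  set Γ := Finset.univ.filter fun τ : Equiv.Perm (Fin k) => ∀ i, u (τ i) = u i with hΓ
  set S := Fintype.piFinset fun i => Finset.range (t (u i)) with hS
  have hΓ0 : (Γ.card : ℂ) ≠ 0 := by
    have : (1 : Equiv.Perm (Fin k)) ∈ Γ := Finset.mem_filter.2 ⟨Finset.mem_univ _, fun _ => rfl⟩
    exact_mod_cast Finset.card_ne_zero_of_mem this
  set Φ := ∑ τ ∈ Γ, F (fun i j => toLex (u (τ i), τ i) ≤ toLex (u (τ j), τ j)) with hΦ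
  have hL : (Γ.card : ℂ) • ∑ s ∈ S, ∑ π : Equiv.Perm (Fin k),
      F (fun i j => toLex (u i, toLex (s i, π i)) ≤ toLex (u j, toLex (s j, π j))) =
      ∑ s ∈ S, ∑ π : Equiv.Perm (Fin k), Φ := by
    rw [Nat.cast_smul_eq_nsmul, ← Finset.sum_const]
    calc _ = ∑ τ ∈ Γ, ∑ s ∈ S, ∑ π : Equiv.Perm (Fin k), F (fun i j =>
          toLex (u (τ i), toLex (s (τ i), π (τ i))) ≤
            toLex (u (τ j), toLex (s (τ j), π (τ j)))) := by
          refine Finset.sum_congr rfl fun τ hτ => ?_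
          have hu : ∀ i, u (τ i) = u i := (Finset.mem_filter.1 hτ).2
          simp_rw [hu]
          symm
          refine Finset.sum_bij' (fun s _ => s ∘ τ) (fun s _ => s ∘ τ.symm) ?_ ?_ ?_ ?_ ?_
          · intro s hs
            rw [hS, Fintype.mem_piFinset] at hs ⊢
            intro i
            have := hs (τ i)
            rwa [hu] at this
          · intro s hs
            rw [hS, Fintype.mem_piFinset] at hs ⊢
            intro i
            have := hs (τ.symm i)
            rwa [← hu, Equiv.apply_symm_apply] at this
          · intro s _
            funext i
            simp
          · intro s _
            funext i
            simp
          · intro s _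
            exact Fintype.sum_equiv (Equiv.mulRight τ) _ _ fun π => rfl
      _ = _ := by
          rw [Finset.sum_comm]
          refine Finset.sum_congr rfl fun s _ => ?_
          rw [Finset.sum_comm]
          refine Finset.sum_congr rfl fun π _ => ?_
          exact sum_stabilizer_lex_eq u F (q := fun i => toLex (s i, π i)) (q' := id)
            (fun i j h => π.injective (congrArg Prod.snd (toLex.injective h)))
            Function.injective_id
  have hR : (Γ.card : ℂ) • ∑ π : Equiv.Perm (Fin k),
      F (fun i j => toLex (u i, π i) ≤ toLex (u j, π j)) = ∑ π : Equiv.Perm (Fin k), Φ := by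
    rw [Nat.cast_smul_eq_nsmul, ← Finset.sum_const]
    calc _ = ∑ τ ∈ Γ, ∑ π : Equiv.Perm (Fin k), F (fun i j =>
          toLex (u (τ i), π (τ i)) ≤ toLex (u (τ j), π (τ j))) := by
          refine Finset.sum_congr rfl fun τ hτ => ?_
          have hu : ∀ i, u (τ i) = u i := (Finset.mem_filter.1 hτ).2
          simp_rw [hu]
          symm
          exact Fintype.sum_equiv (Equiv.mulRight τ) _ _ fun π => rfl
      _ = _ := by
          rw [Finset.sum_comm]
          refine Finset.sum_congr rfl fun π _ => ?_
          exact sum_stabilizer_lex_eq u F (q := fun i => π i) (q' := id) π.injective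
            Function.injective_id
  refine smul_right_injective A hΓ0 ?_
  dsimp only
  rw [hL, smul_comm, hR, Finset.sum_const, hS, Fintype.card_piFinset, ← Nat.cast_prod,
    Nat.cast_smul_eq_nsmul]
  simp only [Finset.card_range]

section

variable {G : Type*} [Monoid G] {n k m : ℕ}

theorem ofFun_mul_ofFun_eq_lex {V P P' : Type*} [PartialOrder P] [Preorder P'] (f : V → P)
    (h : V → P') (c d : V → G) :
    ofFun f c * ofFun h d = ofFun (fun i => toLex (f i, h i)) (c * d) := by
  refine ext_iff'.2 ⟨fun i j => ?_, fun i => rfl⟩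
  simp only [mul_le, ofFun, Prod.Lex.toLex_le_toLex]
  constructor
  · rintro ⟨h1, h2⟩
    rcases h1.lt_or_eq with h | h
    · exact Or.inl h
    · exact Or.inr ⟨h, h2 h.ge⟩
  · rintro (h | ⟨h1, h2⟩)
    · exact ⟨h.le, fun h' => absurd h' (not_le_of_gt h)⟩
    · exact ⟨h1.le, fun _ => h2⟩

theorem sum_ofFun_mul_perm (u : Fin k → Fin m) (t : Fin m → ℕ) (c d : Fin k → G) {A : Type*}
    [AddCommGroup A] [Module ℂ A] (F : ColoredRel (Fin k) G → A) :
    ∑ s ∈ Fintype.piFinset fun i => Finset.range (t (u i)), ∑ π : Equiv.Perm (Fin k),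
      F (ofFun u c * ofFun s 1 * ofFun π d) =
    (∏ i, (t (u i) : ℂ)) • ∑ π : Equiv.Perm (Fin k), F (ofFun u c * ofFun π d) := by
  have h := sum_lex_perm u t (fun R => F ⟨R, c * d⟩)
  simp_rw [mul_assoc, ofFun_mul_ofFun_eq_lex, one_mul]
  exact h

/-! ### Products of colored relations with Eulerian idempotents -/

theorem isFace_blocks_mul {x : Fin n → Fin k} {y : ColoredRel (Fin k) G} (hy : y.IsFace)
    (x' : Fin n → Fin m) (g' : Fin m → G) (h : Fin n → ℕ) :
    (ofFun x' (g' ∘ x') * ofFun h 1 * comap x y).IsFace :=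
  ((isFace_ofFun fun _ _ e => congrArg g' e).mul (isFace_ofFun fun _ _ _ => rfl)).mul (hy.comap x)

/-- Products of Eulerian idempotents vanish if the blocks of the right factor do not refine those of
the left one. The face `y` reorders and relabels the blocks of `x`. -/
theorem eulerian_mul_eq_zero {x : Fin n → Fin k} (x' : Fin n → Fin m)
    (g' : Fin m → G) {y : ColoredRel (Fin k) G} (hy : y.IsFace)
    (hanti : ∀ i j, y.le i j → y.le j i → i = j) {i j : Fin n} (hij : x i = x j)
    (hij' : x' i ≠ x' j) :
    δ (ofFun x' (g' ∘ x')) * eulerian x' * (δ (comap x y) * eulerian x) = 0 := by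
  rw [mul_eulerian, Finset.sum_mul]
  refine Finset.sum_eq_zero fun t _ => ?_
  rw [smul_mul_assoc, Finset.sum_mul, Finset.sum_eq_zero, smul_zero]
  intro h _
  rw [← mul_assoc, ← map_mul, ← map_mul]
  refine face_mul_eulerian_eq_zero (isFace_blocks_mul hy x' g' h) ?_ hij ?_
  · rintro a b ⟨⟨h1, h2⟩, h3⟩ ⟨⟨h4, h5⟩, h6⟩
    exact hanti _ _ (h3 ⟨h4, h5⟩) (h6 ⟨h1, h2⟩)
  · rintro ⟨⟨⟨h1, -⟩, -⟩, ⟨⟨h2, -⟩, -⟩⟩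
    exact hij' (le_antisymm h1 h2)

/-- If `u` merges or reorders the blocks of `x`, then the left factor `eulerian (u ∘ x)` only
contributes through the functions which are constant on the blocks of `x`. -/
theorem eulerian_mul_comap {x : Fin n → Fin k} (hx : Function.Surjective x) (u : Fin k → Fin m)
    (g' : Fin m → G) {y : ColoredRel (Fin k) G} (hy : y.IsFace)
    (hanti : ∀ i j, u i = u j → y.le i j → y.le j i → i = j) :
    δ (ofFun (u ∘ x) (g' ∘ u ∘ x)) * eulerian (u ∘ x) * (δ (comap x y) * eulerian x) =
    ∑ t ∈ Fintype.piFinset fun _ : Fin m => Finset.range (n + 1), (∏ i, linWeight n (t i)) •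
      ∑ s ∈ Fintype.piFinset fun i => Finset.range (t (u i)),
        δ (comap x (ofFun u (g' ∘ u) * ofFun s 1 * y)) * eulerian x := by
  rw [mul_eulerian, Finset.sum_mul]
  refine Finset.sum_congr rfl fun t _ => ?_
  rw [smul_mul_assoc, Finset.sum_mul]
  congr 1
  symm
  refine Finset.sum_of_injOn (fun s => s ∘ x) (hx.injective_comp_right.injOn) ?_ ?_ ?_
  · intro s hs
    rw [Finset.mem_coe, Fintype.mem_piFinset] at hs ⊢
    exact fun v => hs (x v)
  · intro h hh hne
    rw [← mul_assoc, ← map_mul, ← map_mul]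
    -- a function which is not constant on the blocks of `x` splits one of them
    obtain ⟨i, j, hij, hij'⟩ : ∃ i j, x i = x j ∧ h i ≠ h j := by
      by_contra hcon
      push Not at hcon
      choose r hr using hx
      have e : (h ∘ r) ∘ x = h := funext fun v => hcon _ _ (hr (x v))
      refine hne ⟨h ∘ r, ?_, e⟩
      rw [Finset.mem_coe, Fintype.mem_piFinset]
      intro i
      have := Fintype.mem_piFinset.1 hh (r i)
      simpa [hr] using this
    refine face_mul_eulerian_eq_zero (isFace_blocks_mul hy (u ∘ x) g' h) ?_ hij ?_
    · rintro a b ⟨⟨h1, h2⟩, h3⟩ ⟨⟨h4, h5⟩, h6⟩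
      exact hanti _ _ (le_antisymm h1 h4) (h3 ⟨h4, h5⟩) (h6 ⟨h1, h2⟩)
    · rintro ⟨⟨⟨h1, h2⟩, -⟩, ⟨⟨h3, h4⟩, -⟩⟩
      exact hij' (le_antisymm (h2 h3) (h4 h1))
  · intro s _
    rw [← mul_assoc, ← map_mul, ← map_mul]
    rfl

/-- A monomial in the variables `t` has weight `1` if all its exponents are `1`, and `0` otherwise.
-/
theorem sum_weight_mul_prod_cast (u : Fin k → Fin m) (hkn : k ≤ n) :
    ∑ t ∈ Fintype.piFinset fun _ : Fin m => Finset.range (n + 1),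
      (∏ i, linWeight n (t i)) * ∏ i, (t (u i) : ℂ) =
    ∏ j, if (Finset.univ.filter fun i => u i = j).card = 1 then 1 else 0 := by
  rw [sum_weight_mul_prod u (fun _ s => (s : ℂ))]
  refine Finset.prod_congr rfl fun j _ => ?_
  simp_rw [Finset.prod_const]
  refine sum_linWeight_mul_pow (le_trans ?_ hkn)
  exact (Finset.card_le_univ _).trans_eq (Fintype.card_fin k)

theorem le_of_surjective {x : Fin n → Fin k} (hx : Function.Surjective x) : k ≤ n := by
  simpa using Fintype.card_le_of_surjective x hx

/-- If `u` only reorders the blocks, the functions constant on the blocks do not change the face,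
and their weights add up to `1`. -/
theorem eulerian_mul_comap_of_perm {x : Fin n → Fin k} (hx : Function.Surjective x)
    (u : Equiv.Perm (Fin k)) (g' : Fin k → G) {y : ColoredRel (Fin k) G} (hy : y.IsFace) :
    δ (ofFun (u ∘ x) (g' ∘ u ∘ x)) * eulerian (u ∘ x) * (δ (comap x y) * eulerian x) =
      δ (ofFun (u ∘ x) (((g' ∘ u) * y.color) ∘ x)) * eulerian x := by
  rw [eulerian_mul_comap hx u g' hy (fun i j h _ _ => u.injective h)]
  have h : ∀ s : Fin k → ℕ, comap x (ofFun u (g' ∘ u) * ofFun s 1 * y) =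
      ofFun (u ∘ x) (((g' ∘ u) * y.color) ∘ x) := by
    intro s
    refine ext_iff'.2 ⟨fun i j => ?_, fun i => ?_⟩
    · simp only [comap_le, mul_le, ofFun, Function.comp_apply]
      constructor
      · exact fun h => h.1.1
      · intro h1
        refine ⟨⟨h1, fun h2 => ?_⟩, fun h2 => ?_⟩
        · rw [u.injective (le_antisymm h1 h2)]
        · rw [u.injective (le_antisymm h1 h2.1)]
          exact (hy.total _ _).elim id id
    · simp [comap_color, mul_color, ofFun]
  simp_rw [h, Finset.sum_const, Fintype.card_piFinset, Finset.card_range]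
  have h1 := sum_weight_mul_prod_cast (n := n) u (le_of_surjective hx)
  rw [Finset.prod_congr rfl fun j _ => if_pos (Finset.card_eq_one.2 ⟨u.symm j, by
    ext i
    simp [Equiv.eq_symm_apply]⟩), Finset.prod_const_one] at h1
  simp_rw [← Nat.cast_smul_eq_nsmul ℂ, smul_smul]
  rw [← Finset.sum_smul]
  push_cast
  rw [h1, one_smul]

/-- If `u` merges at least two blocks, the sum over all orders of the blocks is annihilated: by
`sum_lex_perm` the functions constant on the blocks act on it by a scalar, which is a monomial of
degree at least two in one of the variables `t` and thus has weight zero. -/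
theorem eulerian_mul_sum_perm_eq_zero {x : Fin n → Fin k} (hx : Function.Surjective x)
    {u : Fin k → Fin m} (hu : ¬ Function.Injective u) (g' : Fin m → G) (g : Fin k → G) :
    δ (ofFun (u ∘ x) (g' ∘ u ∘ x)) * eulerian (u ∘ x) *
      ∑ π : Equiv.Perm (Fin k), (δ (comap x (ofFun π g)) * eulerian x) = 0 := by
  have hπ : ∀ π : Equiv.Perm (Fin k), (ofFun π g).IsFace :=
    fun π => isFace_ofFun fun i j h => congrArg g (π.injective h)
  rw [Finset.mul_sum, Finset.sum_congr rfl fun π _ => eulerian_mul_comap hx u g' (hπ π)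
    fun i j _ h1 h2 => π.injective (le_antisymm h1 h2), Finset.sum_comm]
  simp_rw [← Finset.smul_sum]
  rw [Finset.sum_congr rfl fun t _ => by
    rw [Finset.sum_comm, sum_ofFun_mul_perm u t (g' ∘ u) g fun y => δ (comap x y) * eulerian x]]
  simp_rw [smul_smul]
  rw [← Finset.sum_smul, sum_weight_mul_prod_cast u (le_of_surjective hx)]
  obtain ⟨a, b, hab, hne⟩ : ∃ a b, u a = u b ∧ a ≠ b := by
    simpa only [Function.Injective, not_forall, exists_prop] using hu
  have hcard : (Finset.univ.filter fun i => u i = u a).card ≠ 1 := fun h =>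
    hne (Finset.card_le_one.1 h.le a (by simp) b (by simp [hab]))
  rw [Finset.prod_eq_zero (Finset.mem_univ (u a)) (if_neg hcard), zero_smul]

end

end MantaciReutenauer

/-! ### Characters of `G^k` -/

namespace MantaciReutenauer

open ColoredRel

section Characters

variable {G : Type*} [CommGroup G] {k : ℕ}

/-- The character `g ↦ ∏ᵢ αᵢ(gᵢ)` of `G^k`. -/
noncomputable def pairing (α : Fin k → G →* ℂˣ) : (Fin k → G) →* ℂ :=
  (Units.coeHom ℂ).comp (∏ i, (α i).comp (Pi.evalMonoidHom _ i))

theorem pairing_apply (α : Fin k → G →* ℂˣ) (g : Fin k → G) :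
    pairing α g = ∏ i, ((α i (g i) : ℂˣ) : ℂ) := by
  simp [pairing, MonoidHom.finsetProd_apply]

theorem pairing_comp (α : Fin k → G →* ℂˣ) (g : Fin k → G) (u : Equiv.Perm (Fin k)) :
    pairing (α ∘ u) (g ∘ u) = pairing α g := by
  rw [pairing_apply, pairing_apply]
  exact Equiv.prod_comp u fun i => ((α i (g i) : ℂˣ) : ℂ)

theorem pairing_inv_mul_pairing (α β : Fin k → G →* ℂˣ) (g : Fin k → G) :
    pairing α g⁻¹ * pairing β g = pairing (α⁻¹ * β) g := by
  rw [pairing_apply, pairing_apply, pairing_apply, ← Finset.prod_mul_distrib]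
  simp

theorem sum_pairing [Fintype G] (γ : Fin k → G →* ℂˣ) :
    ∑ g, pairing γ g = if γ = 1 then (Fintype.card G : ℂ) ^ k else 0 := by
  classical
  simp_rw [pairing_apply]
  have h := Finset.prod_univ_sum (fun _ : Fin k => (Finset.univ : Finset G))
    (fun i a => ((γ i a : ℂˣ) : ℂ))
  rw [Fintype.piFinset_univ] at h
  rw [← h]
  have h1 : ∀ i, ∑ a, ((γ i a : ℂˣ) : ℂ) = if γ i = 1 then (Fintype.card G : ℂ) else 0 := by
    intro i
    have := sum_hom_units ((Units.coeHom ℂ).comp (γ i))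
    have e : (Units.coeHom ℂ).comp (γ i) = 1 ↔ γ i = 1 := by
      constructor
      · intro h
        ext a
        simpa using DFunLike.congr_fun h a
      · intro h
        rw [h]
        rfl
    simpa [e] using this
  simp_rw [h1]
  split_ifs with hγ
  · subst hγ
    simp
  · obtain ⟨i, hi⟩ := Function.ne_iff.1 hγ
    exact Finset.prod_eq_zero (Finset.mem_univ i) (if_neg hi)

theorem sum_pairing_inv_mul_pairing [Fintype G] (α β : Fin k → G →* ℂˣ) :
    ∑ g, pairing α g⁻¹ * pairing β g = if α = β then (Fintype.card G : ℂ) ^ k else 0 := by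
  have h : α⁻¹ * β = 1 ↔ α = β :=
    ⟨fun h => funext fun i => inv_mul_eq_one.1 (congrFun h i),
      fun h => funext fun i => inv_mul_eq_one.2 (congrFun h i)⟩
  simp_rw [pairing_inv_mul_pairing, sum_pairing, h]

theorem sum_character_apply [Fintype G] [Fintype (G →* ℂˣ)] [DecidableEq G] (a : G) :
    ∑ χ : G →* ℂˣ, ((χ a : ℂˣ) : ℂ) = if a = 1 then (Fintype.card G : ℂ) else 0 := by
  classical
  have := sum_hom_units ((Units.coeHom ℂ).comp (MonoidHom.eval a : (G →* ℂˣ) →* ℂˣ))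
  have e : (Units.coeHom ℂ).comp (MonoidHom.eval a : (G →* ℂˣ) →* ℂˣ) = 1 ↔ a = 1 := by
    constructor
    · intro h
      by_contra ha
      obtain ⟨χ, hχ⟩ := CommGroup.exists_apply_ne_one_of_hasEnoughRootsOfUnity G ℂ ha
      exact hχ (by simpa using DFunLike.congr_fun h χ)
    · rintro rfl
      ext χ
      simp
  have hc : Fintype.card (G →* ℂˣ) = Fintype.card G :=
    Fintype.card_congr (CommGroup.monoidHom_mulEquiv_of_hasEnoughRootsOfUnity G ℂ).some.toEquiv
  simpa [e, hc] using this

theorem sum_dual_pairing [Fintype G] [Fintype (G →* ℂˣ)] [DecidableEq G] (g g' : Fin k → G) :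
    ∑ α : Fin k → G →* ℂˣ, pairing α g * pairing α g'⁻¹ =
      if g' = g then (Fintype.card G : ℂ) ^ k else 0 := by
  classical
  simp_rw [← map_mul, pairing_apply]
  have h := Finset.prod_univ_sum (fun _ : Fin k => (Finset.univ : Finset (G →* ℂˣ)))
    (fun i χ => ((χ ((g * g'⁻¹) i) : ℂˣ) : ℂ))
  rw [Fintype.piFinset_univ] at h
  rw [← h]
  simp_rw [sum_character_apply]
  split_ifs with hg
  · subst hg
    simp
  · obtain ⟨i, hi⟩ := Function.ne_iff.1 hg
    refine Finset.prod_eq_zero (Finset.mem_univ i) (if_neg fun h => hi ?_)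
    rw [Pi.mul_apply, Pi.inv_apply, mul_inv_eq_one] at h
    exact h.symm

end Characters

/-! ### The idempotents attached to labelled set partitions -/

theorem isFace_ofFun_perm {G : Type*} {k : ℕ} (π : Equiv.Perm (Fin k)) (g : Fin k → G) :
    (ofFun π g).IsFace :=
  isFace_ofFun fun _ _ h => congrArg g (π.injective h)

section

variable {G : Type*} [CommGroup G] [Fintype G] {n k m : ℕ}

/-- For an ordered set partition, encoded as a surjection `x` onto `Fin k`, with its blocks labelled
by characters `α`, the product of the
isotypic components of the first Eulerian idempotents of the blocks. -/
noncomputable def isotypic (x : Fin n → Fin k) (α : Fin k → G →* ℂˣ) : RelAlg (Fin n) G :=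
  ((Fintype.card G : ℂ) ^ k)⁻¹ •
    ∑ g : Fin k → G, pairing α g⁻¹ • (δ (ofFun x (g ∘ x)) * eulerian x)

theorem card_pow_ne_zero (G : Type*) [Nonempty G] [Fintype G] (k : ℕ) :
    (Fintype.card G : ℂ) ^ k ≠ 0 :=
  pow_ne_zero _ (by exact_mod_cast Fintype.card_ne_zero)

theorem isotypic_perm_comp (x : Fin n → Fin k) (α : Fin k → G →* ℂˣ) (u : Equiv.Perm (Fin k)) :
    isotypic (u ∘ x) (α ∘ u.symm) = ((Fintype.card G : ℂ) ^ k)⁻¹ •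
      ∑ g : Fin k → G, pairing α g⁻¹ • (δ (comap x (ofFun u g)) * eulerian x) := by
  rw [isotypic, eulerian_perm_comp]
  congr 1
  refine Fintype.sum_equiv (Equiv.arrowCongr u.symm (Equiv.refl G)) _ _ fun g => ?_
  have h : pairing (α ∘ u.symm) g⁻¹ = pairing α (g ∘ u)⁻¹ := by
    rw [← pairing_comp _ _ u]
    congr 2
    funext i
    simp
  rw [h]
  rfl

/-- Fourier inversion. -/
theorem sum_pairing_smul_isotypic [Fintype (G →* ℂˣ)] (x : Fin n → Fin k) (g : Fin k → G) :
    ∑ α : Fin k → G →* ℂˣ, pairing α g • isotypic x α = δ (ofFun x (g ∘ x)) * eulerian x := by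
  classical
  have h : ∀ α : Fin k → G →* ℂˣ, pairing α g • isotypic x α = ((Fintype.card G : ℂ) ^ k)⁻¹ •
      ∑ g' : Fin k → G, (pairing α g * pairing α g'⁻¹) •
        (δ (ofFun x (g' ∘ x)) * eulerian x) := by
    intro α
    rw [isotypic, smul_comm, Finset.smul_sum]
    simp_rw [smul_smul]
  simp_rw [h]
  rw [← Finset.smul_sum, Finset.sum_comm]
  simp_rw [← Finset.sum_smul, sum_dual_pairing, ite_smul, zero_smul]
  rw [Finset.sum_ite_eq' Finset.univ g, if_pos (Finset.mem_univ g), smul_smul,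
    inv_mul_cancel₀ (card_pow_ne_zero G k), one_smul]

theorem isotypic_mul (x : Fin n → Fin k) (α : Fin k → G →* ℂˣ) (a : RelAlg (Fin n) G) :
    isotypic x α * a = ((Fintype.card G : ℂ) ^ k)⁻¹ •
      ∑ g : Fin k → G, pairing α g⁻¹ • (δ (ofFun x (g ∘ x)) * eulerian x * a) := by
  simp only [isotypic, smul_mul_assoc, Finset.sum_mul]

theorem perm_of_comp_surjective {x : Fin n → Fin k} {u : Fin k → Fin k}
    (h : Function.Surjective (u ∘ x)) : ∃ v : Equiv.Perm (Fin k), u = v :=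
  ⟨Equiv.ofBijective u (Finite.surjective_iff_bijective.1 h.of_comp), rfl⟩

theorem exists_of_not_factors {A B C : Type*} {x : A → B} (hx : Function.Surjective x) {x' : A → C}
    (h : ¬ ∃ u : B → C, x' = u ∘ x) : ∃ i j, x i = x j ∧ x' i ≠ x' j := by
  by_contra hcon
  push Not at hcon
  choose r hr using hx
  exact h ⟨x' ∘ r, funext fun v => (hcon _ _ (hr (x v))).symm⟩

open scoped Classical in
/-- For two set partitions with the same number of blocks, only those which agree up to the order of
the blocks, with the corresponding labels, have a nonzero product. -/
theorem isotypic_mul_isotypic {x x' : Fin n → Fin k} (hx : Function.Surjective x)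
    (hx' : Function.Surjective x') (α α' : Fin k → G →* ℂˣ) :
    isotypic x' α' * isotypic x α =
      if ∃ u : Equiv.Perm (Fin k), x' = u ∘ x ∧ α = α' ∘ u then isotypic x' α' else 0 := by
  have hid : ∀ g : Fin k → G, (ofFun id g).IsFace := isFace_ofFun_perm 1
  by_cases hu : ∃ u : Fin k → Fin k, x' = u ∘ x
  · obtain ⟨u, rfl⟩ := hu
    obtain ⟨u, rfl⟩ := perm_of_comp_surjective hx'
    have hiff : (∃ v : Equiv.Perm (Fin k), u ∘ x = v ∘ x ∧ α = α' ∘ v) ↔ α = α' ∘ u := by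
      constructor
      · rintro ⟨v, h1, h2⟩
        rw [h2, hx.injective_comp_right h1]
      · exact fun h => ⟨u, rfl, h⟩
    simp only [hiff]
    have hmul : ∀ g' g : Fin k → G,
        δ (ofFun (u ∘ x) (g' ∘ (u ∘ x))) * eulerian (u ∘ x) *
          (δ (ofFun x (g ∘ x)) * eulerian x) =
        δ (ofFun (u ∘ x) (((g' ∘ u) * g) ∘ x)) * eulerian x := by
      intro g' g
      have h := eulerian_mul_comap_of_perm hx u g' (hid g)
      rw [comap_ofFun, Function.id_comp] at h
      exact h
    -- translating `g` by `g' ∘ u` separates the two averages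
    have hsum : ∀ g' : Fin k → G,
        δ (ofFun (u ∘ x) (g' ∘ (u ∘ x))) * eulerian (u ∘ x) * isotypic x α =
        pairing α (g' ∘ u) • isotypic (u ∘ x) (α ∘ u.symm) := by
      intro g'
      rw [isotypic_perm_comp, isotypic, mul_smul_comm, Finset.mul_sum, smul_comm (pairing α _)]
      congr 1
      simp_rw [mul_smul_comm, hmul]
      rw [Finset.smul_sum]
      refine Fintype.sum_equiv (Equiv.mulLeft (g' ∘ u)) _ _ fun g => ?_
      rw [smul_smul, ← map_mul]
      congr 2
      simp
    rw [isotypic_mul]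
    simp_rw [hsum, smul_smul]
    have hp : ∀ g' : Fin k → G, pairing α (g' ∘ u) = pairing (α ∘ u.symm) g' := by
      intro g'
      rw [← pairing_comp (α ∘ u.symm) g' u]
      congr 1
      congr 1
      funext i
      simp
    simp_rw [hp]
    rw [← Finset.sum_smul, sum_pairing_inv_mul_pairing, smul_smul]
    have hα : α' = α ∘ u.symm ↔ α = α' ∘ u := by
      constructor <;> rintro rfl <;> funext i <;> simp
    simp only [hα]
    split_ifs with h
    · rw [inv_mul_cancel₀ (card_pow_ne_zero G k), one_smul, ← hα.2 h]
    · rw [mul_zero, zero_smul]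
  · rw [if_neg (fun ⟨u, h, _⟩ => hu ⟨u, h⟩)]
    obtain ⟨i, j, hij, hij'⟩ := exists_of_not_factors hx hu
    rw [isotypic_mul, Finset.sum_eq_zero, smul_zero]
    intro g' _
    rw [isotypic, mul_smul_comm, Finset.mul_sum, Finset.sum_eq_zero, smul_zero, smul_zero]
    intro g _
    rw [mul_smul_comm]
    have h := eulerian_mul_eq_zero x' g' (hid g) (fun _ _ => le_antisymm) hij hij'
    rw [comap_ofFun, Function.id_comp] at h
    rw [h, smul_zero]

/-- For different numbers of blocks, the symmetrization over the orders of the blocks is annihilated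
from the left. -/
theorem isotypic_mul_sum_perm_eq_zero {x : Fin n → Fin k} {x' : Fin n → Fin m}
    (hx : Function.Surjective x) (hx' : Function.Surjective x') (hkm : k ≠ m)
    (α : Fin k → G →* ℂˣ) (α' : Fin m → G →* ℂˣ) :
    isotypic x' α' * ∑ π : Equiv.Perm (Fin k), isotypic (π ∘ x) (α ∘ π.symm) = 0 := by
  simp_rw [isotypic_perm_comp]
  rw [← Finset.smul_sum, Finset.sum_comm, mul_smul_comm, isotypic_mul, Finset.sum_eq_zero,
    smul_zero, smul_zero]
  intro g' _
  rw [Finset.mul_sum, Finset.sum_eq_zero, smul_zero]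
  intro g _
  rw [← Finset.smul_sum, mul_smul_comm]
  by_cases hu : ∃ u : Fin k → Fin m, x' = u ∘ x
  · obtain ⟨u, rfl⟩ := hu
    have hinj : ¬ Function.Injective u := fun h =>
      hkm (by simpa using Fintype.card_of_bijective ⟨h, hx'.of_comp⟩)
    rw [eulerian_mul_sum_perm_eq_zero hx hinj g' g, smul_zero]
  · obtain ⟨i, j, hij, hij'⟩ := exists_of_not_factors hx hu
    rw [Finset.mul_sum, Finset.sum_eq_zero, smul_zero]
    intro π _
    exact eulerian_mul_eq_zero x' g' (isFace_ofFun_perm π g)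
      (fun i j h1 h2 => π.injective (le_antisymm h1 h2)) hij hij'

end

end MantaciReutenauer

/-! ### The idempotents in the algebra of colored relations -/

namespace MantaciReutenauer

open ColoredRel

section

variable {G : Type*} [CommGroup G] {n k m : ℕ}

/-- The multiset of pairs (size, label) of the blocks of a labelled ordered set partition. -/
def blockType {A : Type*} (x : Fin n → Fin k) (α : Fin k → A) : Multiset (ℕ × A) :=
  Finset.univ.val.map fun i => ((Finset.univ.filter fun v => x v = i).card, α i)

theorem card_blockType {A : Type*} (x : Fin n → Fin k) (α : Fin k → A) :
    (blockType x α).card = k := by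
  simp [blockType]

theorem blockType_perm_comp {A : Type*} (x : Fin n → Fin k) (α : Fin k → A)
    (u : Equiv.Perm (Fin k)) : blockType (u ∘ x) (α ∘ u.symm) = blockType x α := by
  have h : (fun i => ((Finset.univ.filter fun v => x v = i).card, α i)) =
      (fun i => ((Finset.univ.filter fun v => (u ∘ x) v = i).card, (α ∘ u.symm) i)) ∘ u := by
    funext i
    simp
  rw [blockType, blockType, h, ← Multiset.map_map]
  congr 1
  have := congrArg Finset.val (Finset.map_univ_equiv u)
  exact this.symm

theorem blockType_comp_perm {A : Type*} (x : Fin n → Fin k) (α : Fin k → A)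
    (σ : Equiv.Perm (Fin n)) : blockType (x ∘ σ) α = blockType x α := by
  have h : ∀ i, (Finset.univ.filter fun v => x (σ v) = i).card =
      (Finset.univ.filter fun v => x v = i).card := by
    intro i
    refine Finset.card_bij (fun v _ => σ v) (fun v hv => by simpa using hv)
      (fun v _ w _ h => σ.injective h) (fun v hv => ⟨σ.symm v, by simpa using hv, by simp⟩)
  simp only [blockType, Function.comp_apply, h]

/-- The colored partition given by the blocks of a labelled ordered set partition. -/
def partitionOf {A : Type*} (x : Fin n → Fin k) (hx : Function.Surjective x) (α : Fin k → A) :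
    ColoredPartition A n where
  parts := blockType x α
  parts_pos := by
    intro p hp
    obtain ⟨i, -, rfl⟩ := Multiset.mem_map.1 hp
    obtain ⟨v, hv⟩ := hx i
    exact Finset.card_pos.2 ⟨v, Finset.mem_filter.2 ⟨Finset.mem_univ _, hv⟩⟩
  parts_sum := by
    rw [blockType, Multiset.map_map]
    change ∑ i : Fin k, (Finset.univ.filter fun v => x v = i).card = n
    rw [← Finset.card_eq_sum_card_fiberwise fun v _ => Finset.mem_coe.2 (Finset.mem_univ (x v)),
      Finset.card_univ, Fintype.card_fin]

open scoped Classical in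
/-- The labelled ordered set partitions of `{0, …, n - 1}` whose blocks are given by `lam`. -/
noncomputable def labelledPartitions [Fintype (G →* ℂˣ)] (lam : ColoredPartition (G →* ℂˣ) n) :
    Finset ((Fin n → Fin lam.parts.card) × (Fin lam.parts.card → G →* ℂˣ)) :=
  Finset.univ.filter fun p => Function.Surjective p.1 ∧ blockType p.1 p.2 = lam.parts

theorem mem_labelledPartitions [Fintype (G →* ℂˣ)] {lam : ColoredPartition (G →* ℂˣ) n}
    {p : (Fin n → Fin lam.parts.card) × (Fin lam.parts.card → G →* ℂˣ)} :
    p ∈ labelledPartitions lam ↔ Function.Surjective p.1 ∧ blockType p.1 p.2 = lam.parts := by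
  simp [labelledPartitions]

theorem perm_mem_labelledPartitions [Fintype (G →* ℂˣ)] {lam : ColoredPartition (G →* ℂˣ) n}
    {p : (Fin n → Fin lam.parts.card) × (Fin lam.parts.card → G →* ℂˣ)}
    (hp : p ∈ labelledPartitions lam) (u : Equiv.Perm (Fin lam.parts.card)) :
    (u ∘ p.1, p.2 ∘ u.symm) ∈ labelledPartitions lam := by
  rw [mem_labelledPartitions] at hp ⊢
  exact ⟨u.surjective.comp hp.1, (blockType_perm_comp _ _ _).trans hp.2⟩

theorem comp_perm_mem_labelledPartitions [Fintype (G →* ℂˣ)] {lam : ColoredPartition (G →* ℂˣ) n}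
    {p : (Fin n → Fin lam.parts.card) × (Fin lam.parts.card → G →* ℂˣ)}
    (hp : p ∈ labelledPartitions lam) (σ : Equiv.Perm (Fin n)) :
    (p.1 ∘ σ, p.2) ∈ labelledPartitions lam := by
  rw [mem_labelledPartitions] at hp ⊢
  exact ⟨hp.1.comp σ.surjective, (blockType_comp_perm _ _ _).trans hp.2⟩

variable [Fintype (G →* ℂˣ)]

theorem sum_perm_labelledPartitions (lam : ColoredPartition (G →* ℂˣ) n)
    (u : Equiv.Perm (Fin lam.parts.card)) {A : Type*} [AddCommMonoid A]
    (F : (Fin n → Fin lam.parts.card) → (Fin lam.parts.card → G →* ℂˣ) → A) :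
    ∑ p ∈ labelledPartitions lam, F (u ∘ p.1) (p.2 ∘ u.symm) =
      ∑ p ∈ labelledPartitions lam, F p.1 p.2 := by
  refine Finset.sum_bij' (fun p _ => (u ∘ p.1, p.2 ∘ u.symm)) (fun p _ => (u.symm ∘ p.1, p.2 ∘ u))
    (fun p hp => perm_mem_labelledPartitions hp u)
    (fun p hp => perm_mem_labelledPartitions hp u.symm) ?_ ?_ (fun p _ => rfl)
  · rintro ⟨x, α⟩ _
    simp [← Function.comp_assoc, Function.comp_assoc α]
  · rintro ⟨x, α⟩ _
    simp [← Function.comp_assoc, Function.comp_assoc α]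

theorem sum_comp_perm_labelledPartitions (lam : ColoredPartition (G →* ℂˣ) n)
    (σ : Equiv.Perm (Fin n)) {A : Type*} [AddCommMonoid A]
    (F : (Fin n → Fin lam.parts.card) → (Fin lam.parts.card → G →* ℂˣ) → A) :
    ∑ p ∈ labelledPartitions lam, F (p.1 ∘ σ) p.2 =
      ∑ p ∈ labelledPartitions lam, F p.1 p.2 := by
  refine Finset.sum_bij' (fun p _ => (p.1 ∘ σ, p.2)) (fun p _ => (p.1 ∘ σ.symm, p.2))
    (fun p hp => comp_perm_mem_labelledPartitions hp σ)
    (fun p hp => comp_perm_mem_labelledPartitions hp σ.symm) ?_ ?_ (fun p _ => rfl)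
  · rintro ⟨x, α⟩ _
    simp [Function.comp_assoc]
  · rintro ⟨x, α⟩ _
    simp [Function.comp_assoc]

/-- There are `ℓ!` pairs `(x, α)` related to a given `(x', α')` by a permutation of the blocks,
where `ℓ` is the number of blocks. -/
theorem sum_related {lam : ColoredPartition (G →* ℂˣ) n} {x' : Fin n → Fin lam.parts.card}
    {α' : Fin lam.parts.card → G →* ℂˣ} (h : (x', α') ∈ labelledPartitions lam)
    {A : Type*} [AddCommMonoid A] (a : A)
    (P : (Fin n → Fin lam.parts.card) × (Fin lam.parts.card → G →* ℂˣ) → Prop) [DecidablePred P]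
    (hP : ∀ p, P p ↔ ∃ u : Equiv.Perm (Fin lam.parts.card), x' = u ∘ p.1 ∧ p.2 = α' ∘ u) :
    ∑ p ∈ labelledPartitions lam, (if P p then a else 0) = lam.parts.card.factorial • a := by
  classical
  have hx' := (mem_labelledPartitions.1 h).1
  symm
  have hc : (Finset.univ : Finset (Equiv.Perm (Fin lam.parts.card))).card =
      lam.parts.card.factorial := by
    rw [Finset.card_univ, Fintype.card_perm, Fintype.card_fin]
  rw [← hc, ← Finset.sum_const]
  refine Finset.sum_of_injOn (fun u => (u ∘ x', α' ∘ u.symm)) ?_ ?_ ?_ ?_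
  · intro u _ v _ huv
    have h1 : (u : Fin lam.parts.card → _) ∘ x' = v ∘ x' := congrArg Prod.fst huv
    exact DFunLike.coe_injective (hx'.injective_comp_right h1)
  · intro u _
    exact perm_mem_labelledPartitions h u
  · rintro ⟨x, α⟩ _ hne
    refine if_neg fun hp => hne ?_
    obtain ⟨u, h1, h2⟩ := (hP _).1 hp
    dsimp only at h1 h2
    refine ⟨u.symm, Finset.mem_coe.2 (Finset.mem_univ _), ?_⟩
    rw [h1, h2]
    simp [← Function.comp_assoc]
  · intro u _
    rw [if_pos]
    refine (hP _).2 ⟨u.symm, ?_, rfl⟩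
    simp [← Function.comp_assoc]

theorem factorial_cast_ne_zero (k : ℕ) : (k.factorial : ℂ) ≠ 0 := by
  exact_mod_cast k.factorial_ne_zero

variable [Fintype G]

/-- The idempotent of the algebra of colored relations attached to `lam`. Each unordered labelled
set partition of type `lam` contributes once for each of the `ℓ!` orders of its blocks. -/
noncomputable def relIdem (lam : ColoredPartition (G →* ℂˣ) n) : RelAlg (Fin n) G :=
  (lam.parts.card.factorial : ℂ)⁻¹ • ∑ p ∈ labelledPartitions lam, isotypic p.1 p.2

open scoped Classical in
/-- Right multiplication by the idempotents is diagonal on the elements `isotypic x α`. -/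
theorem isotypic_mul_relIdem {x' : Fin n → Fin m} (hx' : Function.Surjective x')
    (α' : Fin m → G →* ℂˣ) (lam : ColoredPartition (G →* ℂˣ) n) :
    isotypic x' α' * relIdem lam =
      if blockType x' α' = lam.parts then isotypic x' α' else 0 := by
  rw [relIdem, mul_smul_comm]
  by_cases hm : lam.parts.card = m
  · subst hm
    rw [Finset.mul_sum, Finset.sum_congr rfl fun p hp =>
      isotypic_mul_isotypic (mem_labelledPartitions.1 hp).1 hx' p.2 α']
    split_ifs with h
    · rw [sum_related (mem_labelledPartitions.2 ⟨hx', h⟩) (isotypic x' α') _ (fun _ => Iff.rfl),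
        ← Nat.cast_smul_eq_nsmul ℂ, smul_smul, inv_mul_cancel₀ (factorial_cast_ne_zero _),
        one_smul]
    · rw [Finset.sum_eq_zero, smul_zero]
      rintro ⟨x, α⟩ hp
      refine if_neg ?_
      rintro ⟨u, h1, h2⟩
      dsimp only at h1 h2
      subst h1 h2
      refine h (Eq.trans ?_ (mem_labelledPartitions.1 hp).2)
      dsimp only
      rw [← blockType_perm_comp x (α' ∘ u) u]
      congr 1
      funext i
      simp
  · rw [if_neg]
    swap
    · intro h
      exact hm (by rw [← h, card_blockType])
    have h : (lam.parts.card.factorial : ℂ) •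
        (isotypic x' α' * ∑ p ∈ labelledPartitions lam, isotypic p.1 p.2) = 0 := by
      have hc : (Finset.univ : Finset (Equiv.Perm (Fin lam.parts.card))).card =
          lam.parts.card.factorial := by
        rw [Finset.card_univ, Fintype.card_perm, Fintype.card_fin]
      rw [Nat.cast_smul_eq_nsmul, ← hc, ← Finset.sum_const]
      calc _ = ∑ u : Equiv.Perm (Fin lam.parts.card),
            isotypic x' α' * ∑ p ∈ labelledPartitions lam, isotypic (u ∘ p.1) (p.2 ∘ u.symm) :=
            Finset.sum_congr rfl fun u _ => by rw [sum_perm_labelledPartitions lam u isotypic]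
        _ = isotypic x' α' * ∑ p ∈ labelledPartitions lam,
            ∑ u : Equiv.Perm (Fin lam.parts.card), isotypic (u ∘ p.1) (p.2 ∘ u.symm) := by
            rw [← Finset.mul_sum, Finset.sum_comm]
        _ = 0 := by
            rw [Finset.mul_sum]
            exact Finset.sum_eq_zero fun p hp =>
              isotypic_mul_sum_perm_eq_zero (mem_labelledPartitions.1 hp).1 hx' hm _ _
    rw [(smul_eq_zero.1 h).resolve_left (factorial_cast_ne_zero _), smul_zero]

/-- The span of the elements `isotypic x α`. -/
noncomputable def isotypicSpan (G : Type*) [CommGroup G] [Fintype G] (n : ℕ) :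
    Submodule ℂ (RelAlg (Fin n) G) :=
  Submodule.span ℂ {a | ∃ (k : ℕ) (x : Fin n → Fin k) (α : Fin k → G →* ℂˣ),
    Function.Surjective x ∧ a = isotypic x α}

theorem ofFun_mul_eulerian_mem_isotypicSpan {x : Fin n → Fin k} (hx : Function.Surjective x)
    (g : Fin k → G) : δ (ofFun x (g ∘ x)) * eulerian x ∈ isotypicSpan G n := by
  rw [← sum_pairing_smul_isotypic]
  exact Submodule.sum_mem _ fun α _ => Submodule.smul_mem _ _
    (Submodule.subset_span ⟨k, x, α, hx, rfl⟩)

/-- The element `y * eulerian x` attached to a face `y` with blocks `x` is unitriangular with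
respect to refinement, so the faces are in the span of the elements `isotypic x α`. -/
theorem δ_mem_isotypicSpan {y : ColoredRel (Fin n) G} (hy : y.IsFace) :
    δ y ∈ isotypicSpan G n := by
  classical
  induction hN : (Finset.univ.filter fun p : Fin n × Fin n => y.le p.1 p.2).card
    using Nat.strong_induction_on generalizing y with
  | _ N ih =>
    obtain ⟨k, x, g, hx, hyx⟩ := hy.exists_ofFun
    have hL := ofFun_mul_eulerian_mem_isotypicSpan hx g
    have hcoeff : (δ y * eulerian x).coeff y = 1 := by
      have h := coeff_mul_eulerian x (g ∘ x) id (fun _ => 0)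
      have e : ofFun x (g ∘ x) * ofFun (fun _ => 0) 1 = ofFun x (g ∘ x) := by
        refine ext_iff'.2 ⟨fun i j => ?_, fun i => ?_⟩
        · simp [mul_le, ofFun]
        · simp [mul_color, ofFun]
      rw [Function.id_comp, e, ← hyx] at h
      rw [h]
      refine Finset.prod_eq_one fun i _ => ?_
      obtain ⟨v, hv⟩ := hx i
      have h1 : (Finset.univ.filter fun j : Fin k => id j = i) = {i} := by
        ext j
        simp
      have h2 : ((Finset.univ.filter fun v => x v = i).image fun _ : Fin n => 0) = {0} :=
        Finset.image_const ⟨v, by simp [hv]⟩ 0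
      have hn : 1 ≤ n := v.pos
      simp only [h1, Finset.prod_singleton, h2, Finset.card_singleton]
      rw [sum_linWeight_mul_choose one_ne_zero hn]
      norm_num
    have hrest : δ y * eulerian x - δ y ∈ isotypicSpan G n := by
      have hone : (δ y : RelAlg (Fin n) G) =
          ∑ t ∈ Fintype.piFinset fun _ : Fin k => Finset.range (n + 1), (∏ i, linWeight n (t i)) •
            ∑ h ∈ Fintype.piFinset fun v => Finset.range (t (x v)),
              (if y * ofFun h 1 = y then (1 : ℂ) else 0) • (δ y : RelAlg (Fin n) G) := by
        conv_lhs => rw [← one_smul ℂ (δ y), ← hcoeff]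
        rw [mul_eulerian, MonoidAlgebra.coeff_sum, Finsupp.finsetSum_apply, Finset.sum_smul]
        refine Finset.sum_congr rfl fun t _ => ?_
        rw [MonoidAlgebra.coeff_smul_apply, MonoidAlgebra.coeff_sum, Finsupp.finsetSum_apply,
          smul_assoc, Finset.sum_smul]
        congr 1
        refine Finset.sum_congr rfl fun h _ => ?_
        rw [← map_mul, coeff_δ]
      have e := congrArg (fun b => δ y * eulerian x - b) hone
      rw [e, mul_eulerian]
      rw [← Finset.sum_sub_distrib]
      refine Submodule.sum_mem _ fun t _ => ?_
      rw [← smul_sub, ← Finset.sum_sub_distrib]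
      refine Submodule.smul_mem _ _ (Submodule.sum_mem _ fun h _ => ?_)
      rw [← map_mul]
      split_ifs with heq
      · rw [heq, one_smul, sub_self]
        exact Submodule.zero_mem _
      · rw [zero_smul, sub_zero]
        refine ih _ ?_ (hy.mul (isFace_ofFun fun _ _ _ => rfl)) rfl
        rw [← hN]
        refine Finset.card_lt_card ⟨fun p hp => ?_, fun hsub => heq ?_⟩
        · rw [Finset.mem_filter] at hp ⊢
          exact ⟨hp.1, hp.2.1⟩
        · refine ext_iff'.2 ⟨fun i j => ⟨fun h => h.1, fun hij => ?_⟩, fun i => mul_one _⟩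
          exact (Finset.mem_filter.1 (@hsub (i, j)
            (Finset.mem_filter.2 ⟨Finset.mem_univ _, hij⟩))).2
    have := Submodule.sub_mem _ (hyx ▸ hL) hrest
    rwa [sub_sub_cancel] at this

theorem mul_sum_relIdem [Fintype (ColoredPartition (G →* ℂˣ) n)] {a : RelAlg (Fin n) G}
    (ha : a ∈ isotypicSpan G n) :
    a * ∑ lam : ColoredPartition (G →* ℂˣ) n, relIdem lam = a := by
  classical
  induction ha using Submodule.span_induction with
  | mem a ha =>
    obtain ⟨k, x, α, hx, rfl⟩ := ha
    rw [Finset.mul_sum]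
    simp_rw [isotypic_mul_relIdem hx]
    rw [Finset.sum_eq_single (partitionOf x hx α)]
    · exact if_pos rfl
    · intro lam _ hne
      exact if_neg fun h => hne (ColoredPartition.ext h.symm)
    · simp
  | zero => rw [zero_mul]
  | add a b _ _ ha hb => rw [add_mul, ha, hb]
  | smul c a _ ha => rw [smul_mul_assoc, ha]

/-- By `isotypic_mul_relIdem` the sum acts as the identity from the right on the span of the
elements `isotypic x α`, which contains the unit. -/
theorem sum_relIdem [Fintype (ColoredPartition (G →* ℂˣ) n)] :
    ∑ lam : ColoredPartition (G →* ℂˣ) n, relIdem lam = 1 := by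
  have h := mul_sum_relIdem (δ_mem_isotypicSpan (G := G) (n := n) isFace_one)
  rwa [map_one, one_mul] at h

open scoped Classical in
theorem relIdem_mul_relIdem (lam mu : ColoredPartition (G →* ℂˣ) n) :
    relIdem lam * relIdem mu = if lam = mu then relIdem lam else 0 := by
  conv_lhs => rw [relIdem]
  rw [smul_mul_assoc, Finset.sum_mul, Finset.sum_congr rfl fun p hp => by
    rw [isotypic_mul_relIdem (mem_labelledPartitions.1 hp).1, (mem_labelledPartitions.1 hp).2]]
  by_cases h : lam = mu
  · subst h
    simp only [if_true]
    rfl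
  · rw [if_neg h, Finset.sum_eq_zero fun p _ => if_neg fun e => h (ColoredPartition.ext e),
      smul_zero]

/-- The left ideal generated by `relIdem lam` is spanned by the elements `isotypic x α` of type
`lam`. -/
theorem mul_relIdem_mem {a : RelAlg (Fin n) G} (ha : a ∈ isotypicSpan G n)
    (lam : ColoredPartition (G →* ℂˣ) n) :
    a * relIdem lam ∈ Submodule.span ℂ
      ((fun p => isotypic p.1 p.2) '' (labelledPartitions lam : Set
        ((Fin n → Fin lam.parts.card) × (Fin lam.parts.card → G →* ℂˣ)))) := by
  classical
  induction ha using Submodule.span_induction with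
  | mem a ha =>
    obtain ⟨k, x, α, hx, rfl⟩ := ha
    rw [isotypic_mul_relIdem hx]
    split_ifs with h
    · have hk : k = lam.parts.card := by rw [← h, card_blockType]
      subst hk
      exact Submodule.subset_span ⟨(x, α), Finset.mem_coe.2 (mem_labelledPartitions.2 ⟨hx, h⟩), rfl⟩
    · exact Submodule.zero_mem _
  | zero =>
    rw [zero_mul]
    exact Submodule.zero_mem _
  | add a b _ _ ha hb =>
    rw [add_mul]
    exact Submodule.add_mem _ ha hb
  | smul c a _ ha =>
    rw [smul_mul_assoc]
    exact Submodule.smul_mem _ _ ha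

theorem relIdem_mul_isotypic {lam : ColoredPartition (G →* ℂˣ) n}
    {x : Fin n → Fin lam.parts.card} {α : Fin lam.parts.card → G →* ℂˣ}
    (h : (x, α) ∈ labelledPartitions lam) :
    relIdem lam * isotypic x α = (lam.parts.card.factorial : ℂ)⁻¹ •
      ∑ u : Equiv.Perm (Fin lam.parts.card), isotypic (u ∘ x) (α ∘ u.symm) := by
  classical
  have hx := (mem_labelledPartitions.1 h).1
  rw [relIdem, smul_mul_assoc, Finset.sum_mul]
  congr 1
  rw [Finset.sum_congr rfl fun p hp =>
    isotypic_mul_isotypic hx (mem_labelledPartitions.1 hp).1 α p.2]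
  symm
  refine Finset.sum_of_injOn (fun u => (u ∘ x, α ∘ u.symm)) ?_ ?_ ?_ ?_
  · intro u _ v _ huv
    have h1 : (u : Fin lam.parts.card → _) ∘ x = v ∘ x := congrArg Prod.fst huv
    exact DFunLike.coe_injective (hx.injective_comp_right h1)
  · intro u _
    exact perm_mem_labelledPartitions h u
  · rintro ⟨x', α'⟩ _ hne
    refine if_neg ?_
    rintro ⟨u, h1, h2⟩
    dsimp only at h1 h2
    refine hne ⟨u, Finset.mem_coe.2 (Finset.mem_univ _), ?_⟩
    rw [h1, h2]
    simp [Function.comp_assoc]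
  · intro u _
    rw [if_pos]
    refine ⟨u, rfl, ?_⟩
    simp [Function.comp_assoc]

end

end MantaciReutenauer

/-! ### Invariants of the symmetric group -/

namespace MantaciReutenauer

open ColoredRel

/-- Two families with the same multiset of values differ by a permutation. -/
theorem exists_perm_of_map_eq {T B : Type*} [Fintype T] {f f' : T → B}
    (h : (Finset.univ : Finset T).val.map f = (Finset.univ : Finset T).val.map f') :
    ∃ u : Equiv.Perm T, f = f' ∘ u := by
  classical
  have hc : ∀ b, Fintype.card {t // f t = b} = Fintype.card {t // f' t = b} := by
    intro b
    rw [Fintype.card_subtype, Fintype.card_subtype]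
    have := congrArg (Multiset.count b) h
    rw [Multiset.count_map, Multiset.count_map] at this
    simpa [Finset.card, eq_comm] using this
  have e : ∀ b, {t // f t = b} ≃ {t // f' t = b} := fun b => Fintype.equivOfCardEq (hc b)
  refine ⟨(Equiv.sigmaFiberEquiv f).symm.trans
    ((Equiv.sigmaCongrRight e).trans (Equiv.sigmaFiberEquiv f')), ?_⟩
  funext t
  exact ((e (f t)) ⟨t, rfl⟩).2.symm

section

variable {G : Type*} [CommGroup G] {n k m : ℕ}

/-- The pullback along a permutation, on the algebra of colored relations. -/
noncomputable def pull (σ : Equiv.Perm (Fin n)) : RelAlg (Fin n) G →ₐ[ℂ] RelAlg (Fin n) G :=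
  MonoidAlgebra.mapDomainAlgHom ℂ ℂ (comap σ)

theorem pull_δ (σ : Equiv.Perm (Fin n)) (y : ColoredRel (Fin n) G) :
    pull σ (δ y) = δ (comap σ y) := by
  simp [pull]

theorem pull_eulerian (σ : Equiv.Perm (Fin n)) (x : Fin n → Fin k) :
    pull σ (eulerian x : RelAlg (Fin n) G) = eulerian (x ∘ σ) := by
  rw [eulerian, eulerian, map_sum]
  refine Finset.sum_congr rfl fun t _ => ?_
  rw [map_smul, map_sum]
  congr 1
  refine Finset.sum_bij' (fun h _ => h ∘ σ) (fun h _ => h ∘ σ.symm) ?_ ?_ ?_ ?_ ?_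
  · intro h hh
    rw [Fintype.mem_piFinset] at hh ⊢
    exact fun v => hh (σ v)
  · intro h hh
    rw [Fintype.mem_piFinset] at hh ⊢
    intro v
    simpa using hh (σ.symm v)
  · intro h _
    simp [Function.comp_assoc]
  · intro h _
    simp [Function.comp_assoc]
  · intro h _
    rw [pull_δ, comap_ofFun]
    rfl

theorem pull_isotypic [Fintype G] (σ : Equiv.Perm (Fin n)) (x : Fin n → Fin k)
    (α : Fin k → G →* ℂˣ) : pull σ (isotypic x α) = isotypic (x ∘ σ) α := by
  simp only [isotypic, map_smul, map_sum, map_mul (pull σ), pull_δ, pull_eulerian, comap_ofFun,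
    Function.comp_assoc]

/-- The span of the faces. -/
noncomputable def faceSpan (G : Type*) [CommGroup G] (n : ℕ) : Submodule ℂ (RelAlg (Fin n) G) :=
  Submodule.span ℂ (δ '' {y | y.IsFace})

theorem δ_mem_faceSpan {y : ColoredRel (Fin n) G} (hy : y.IsFace) : δ y ∈ faceSpan G n :=
  Submodule.subset_span ⟨y, hy, rfl⟩

theorem mul_mem_faceSpan {a b : RelAlg (Fin n) G} (ha : a ∈ faceSpan G n) (hb : b ∈ faceSpan G n) :
    a * b ∈ faceSpan G n := by
  have h := Submodule.mul_mem_mul ha hb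
  rw [faceSpan, Submodule.span_mul_span] at h
  refine Submodule.span_mono ?_ h
  rintro _ ⟨_, ⟨y, hy, rfl⟩, _, ⟨z, hz, rfl⟩, rfl⟩
  exact ⟨y * z, hy.mul hz, map_mul _ _ _⟩

theorem isFace_of_coeff_ne_zero {a : RelAlg (Fin n) G} (ha : a ∈ faceSpan G n)
    {y : ColoredRel (Fin n) G} (hy : a.coeff y ≠ 0) : y.IsFace := by
  classical
  by_contra hcon
  refine hy ?_
  clear hy
  induction ha using Submodule.span_induction with
  | mem a ha =>
    obtain ⟨z, hz, rfl⟩ := ha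
    rw [coeff_δ, if_neg]
    rintro rfl
    exact hcon hz
  | zero => rfl
  | add a b _ _ ha hb => rw [MonoidAlgebra.coeff_add, Finsupp.add_apply, ha, hb, add_zero]
  | smul c a _ ha => rw [MonoidAlgebra.coeff_smul_apply, ha, smul_zero]

/-- The invariants of the symmetric group in the algebra of ordered set partitions with blocks
labelled by `G`. -/
noncomputable def faceInvariants (G : Type*) [CommGroup G] (n : ℕ) :
    Subalgebra ℂ (RelAlg (Fin n) G) where
  carrier := {a | a ∈ faceSpan G n ∧ ∀ σ, pull σ a = a}
  mul_mem' ha hb := ⟨mul_mem_faceSpan ha.1 hb.1, fun σ => by rw [map_mul, ha.2, hb.2]⟩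
  add_mem' ha hb := ⟨Submodule.add_mem _ ha.1 hb.1, fun σ => by rw [map_add, ha.2, hb.2]⟩
  algebraMap_mem' c := ⟨by
    rw [Algebra.algebraMap_eq_smul_one, ← map_one (δ : ColoredRel (Fin n) G →* _)]
    exact Submodule.smul_mem _ _ (δ_mem_faceSpan isFace_one), fun σ => AlgHom.commutes _ _⟩

theorem coeff_comap_of_mem {a : RelAlg (Fin n) G} (ha : a ∈ faceInvariants G n)
    (σ : Equiv.Perm (Fin n)) (y : ColoredRel (Fin n) G) :
    a.coeff (comap σ y) = a.coeff y := by
  conv_lhs => rw [← ha.2 σ]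
  have hinj : Function.Injective (comap σ : ColoredRel (Fin n) G →* ColoredRel (Fin n) G) := by
    intro y z h
    have : comap σ.symm (comap σ y) = comap σ.symm (comap σ z) := by rw [h]
    refine ext_iff'.2 ⟨fun i j => ?_, fun i => ?_⟩
    · simpa [comap_le] using (ext_iff'.1 this).1 i j
    · simpa [comap_color] using (ext_iff'.1 this).2 i
  exact Finsupp.mapDomain_apply hinj a.coeff y

theorem sum_pull_mem {a : RelAlg (Fin n) G} (ha : a ∈ faceSpan G n) :
    ∑ σ : Equiv.Perm (Fin n), pull σ a ∈ faceInvariants G n := by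
  refine ⟨Submodule.sum_mem _ fun σ _ => ?_, fun τ => ?_⟩
  · induction ha using Submodule.span_induction with
    | mem a ha =>
      obtain ⟨y, hy, rfl⟩ := ha
      rw [pull_δ]
      exact δ_mem_faceSpan (hy.comap σ)
    | zero => simp
    | add a b _ _ ha hb =>
      rw [map_add]
      exact Submodule.add_mem _ ha hb
    | smul c a _ ha =>
      rw [map_smul]
      exact Submodule.smul_mem _ _ ha
  · rw [map_sum]
    refine Fintype.sum_equiv (Equiv.mulRight τ) _ _ fun σ => ?_
    rw [pull, pull, pull, ← AlgHom.comp_apply, ← MonoidAlgebra.mapDomainAlgHom_comp]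
    rfl

theorem eulerian_mem_faceSpan (x : Fin n → Fin k) : eulerian x ∈ faceSpan G n :=
  Submodule.sum_mem _ fun _ _ => Submodule.smul_mem _ _ (Submodule.sum_mem _ fun _ _ =>
    δ_mem_faceSpan (isFace_ofFun fun _ _ _ => rfl))

theorem isotypic_mem_faceSpan [Fintype G] (x : Fin n → Fin k) (α : Fin k → G →* ℂˣ) :
    isotypic x α ∈ faceSpan G n :=
  Submodule.smul_mem _ _ (Submodule.sum_mem _ fun g _ => Submodule.smul_mem _ _
    (mul_mem_faceSpan (δ_mem_faceSpan (isFace_ofFun fun _ _ h => congrArg g h))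
      (eulerian_mem_faceSpan x)))

variable [Fintype (G →* ℂˣ)]

/-- Two labelled ordered set partitions of the same type differ by a permutation of the ground set
and a permutation of the blocks. -/
theorem exists_perm_perm_of_mem {lam : ColoredPartition (G →* ℂˣ) n}
    {p q : (Fin n → Fin lam.parts.card) × (Fin lam.parts.card → G →* ℂˣ)}
    (hp : p ∈ labelledPartitions lam) (hq : q ∈ labelledPartitions lam) :
    ∃ (u : Equiv.Perm (Fin lam.parts.card)) (σ : Equiv.Perm (Fin n)),
      q.1 = u ∘ p.1 ∘ σ ∧ q.2 = p.2 ∘ u.symm := by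
  classical
  obtain ⟨x, α⟩ := p
  obtain ⟨x', α'⟩ := q
  have h : blockType x α = blockType x' α' :=
    ((mem_labelledPartitions.1 hp).2).trans ((mem_labelledPartitions.1 hq).2).symm
  obtain ⟨u, hu⟩ := exists_perm_of_map_eq h
  have h1 : ∀ i, (Finset.univ.filter fun v => x v = i).card =
      (Finset.univ.filter fun v => x' v = u i).card := fun i => congrArg Prod.fst (congrFun hu i)
  have h2 : ∀ i, α i = α' (u i) := fun i => congrArg Prod.snd (congrFun hu i)
  have h3 : (Finset.univ : Finset (Fin n)).val.map x' =
      (Finset.univ : Finset (Fin n)).val.map (u ∘ x) := by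
    ext i
    rw [Multiset.count_map, Multiset.count_map]
    have := h1 (u.symm i)
    rw [Equiv.apply_symm_apply] at this
    simp only [Finset.card, Finset.filter_val] at this
    simp only [Function.comp_apply, eq_comm (a := i)]
    rw [← this]
    congr 2
    funext v
    rw [Equiv.eq_symm_apply]
  obtain ⟨σ, hσ⟩ := exists_perm_of_map_eq h3
  refine ⟨u, σ, hσ, ?_⟩
  funext i
  simp [h2]

variable [Fintype G]

theorem relIdem_mem_faceInvariants (lam : ColoredPartition (G →* ℂˣ) n) :
    relIdem lam ∈ faceInvariants G n := by
  refine ⟨Submodule.smul_mem _ _ (Submodule.sum_mem _ fun _ _ => isotypic_mem_faceSpan _ _),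
    fun σ => ?_⟩
  rw [relIdem, map_smul, map_sum]
  simp_rw [pull_isotypic]
  rw [sum_comp_perm_labelledPartitions lam σ isotypic]

theorem faceSpan_le_isotypicSpan : faceSpan G n ≤ isotypicSpan G n := by
  rw [faceSpan, Submodule.span_le]
  rintro _ ⟨y, hy, rfl⟩
  exact δ_mem_isotypicSpan hy

/-- The corner of the algebra of invariants defined by `relIdem lam` is at most one-dimensional. The
left ideal generated by `relIdem lam` is spanned by the elements `isotypic x α` of type `lam`; left
multiplication by `relIdem lam` averages these over the orders of the blocks, and averaging over the
symmetric group of the ground set then makes them all proportional to `relIdem lam`. -/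
theorem exists_smul_of_corner {a : RelAlg (Fin n) G} (ha : a ∈ faceInvariants G n)
    (lam : ColoredPartition (G →* ℂˣ) n) :
    ∃ c : ℂ, relIdem lam * (a * relIdem lam) = c • relIdem lam := by
  have hn := factorial_cast_ne_zero n
  have hmem := (faceInvariants G n).mul_mem (relIdem_mem_faceInvariants lam)
    ((faceInvariants G n).mul_mem ha (relIdem_mem_faceInvariants lam))
  have hT := mul_relIdem_mem (faceSpan_le_isotypicSpan ha.1) lam
  suffices h : ∀ b ∈ Submodule.span ℂ ((fun p => isotypic p.1 p.2) ''
      (labelledPartitions lam : Set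
        ((Fin n → Fin lam.parts.card) × (Fin lam.parts.card → G →* ℂˣ)))),
      ∃ c : ℂ, ∑ σ : Equiv.Perm (Fin n), pull σ (relIdem lam * b) = c • relIdem lam by
    obtain ⟨c, hc⟩ := h _ hT
    simp_rw [hmem.2] at hc
    rw [Finset.sum_const, Finset.card_univ, Fintype.card_perm, Fintype.card_fin,
      ← Nat.cast_smul_eq_nsmul ℂ] at hc
    refine ⟨(n.factorial : ℂ)⁻¹ * c, ?_⟩
    rw [mul_smul, ← hc, smul_smul, inv_mul_cancel₀ hn, one_smul]
  intro b hb
  induction hb using Submodule.span_induction with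
  | mem b hb =>
    obtain ⟨p, hp, rfl⟩ := hb
    rw [Finset.mem_coe] at hp
    -- the average over both symmetric groups is the same for all elements of `labelledPartitions`
    let D : (Fin n → Fin lam.parts.card) × (Fin lam.parts.card → G →* ℂˣ) → RelAlg (Fin n) G :=
      fun p => ∑ σ : Equiv.Perm (Fin n), ∑ u : Equiv.Perm (Fin lam.parts.card),
        isotypic (u ∘ p.1 ∘ σ) (p.2 ∘ u.symm)
    have hD : ∀ q ∈ labelledPartitions lam, D q = D p := by
      intro q hq
      obtain ⟨u₀, σ₀, h1, h2⟩ := exists_perm_perm_of_mem hp hq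
      simp only [D]
      refine Fintype.sum_equiv (Equiv.mulLeft σ₀) _ _ fun σ => ?_
      refine Fintype.sum_equiv (Equiv.mulRight u₀) _ _ fun u => ?_
      rw [h1, h2]
      rfl
    have hsum : (labelledPartitions lam).card • D p =
        ((n.factorial : ℂ) * lam.parts.card.factorial) •
          ∑ q ∈ labelledPartitions lam, isotypic q.1 q.2 := by
      rw [← Finset.sum_const, ← Finset.sum_congr rfl hD]
      simp only [D]
      rw [Finset.sum_comm, Finset.sum_congr rfl fun σ _ => Finset.sum_comm]
      have h : ∀ (σ : Equiv.Perm (Fin n)) (u : Equiv.Perm (Fin lam.parts.card)),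
          ∑ q ∈ labelledPartitions lam, isotypic (u ∘ q.1 ∘ σ) (q.2 ∘ u.symm) =
            ∑ q ∈ labelledPartitions lam, isotypic q.1 q.2 := by
        intro σ u
        rw [sum_comp_perm_labelledPartitions lam σ fun x α => isotypic (u ∘ x) (α ∘ u.symm),
          sum_perm_labelledPartitions lam u isotypic]
      simp_rw [h]
      rw [Finset.sum_const, Finset.sum_const, Finset.card_univ, Finset.card_univ, Fintype.card_perm,
        Fintype.card_perm, Fintype.card_fin, Fintype.card_fin, ← Nat.cast_smul_eq_nsmul ℂ,
        ← Nat.cast_smul_eq_nsmul ℂ, smul_smul]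
    have hc : ((labelledPartitions lam).card : ℂ) ≠ 0 := by
      exact_mod_cast Finset.card_ne_zero_of_mem hp
    have hF : ∑ q ∈ labelledPartitions lam, isotypic q.1 q.2 =
        (lam.parts.card.factorial : ℂ) • relIdem lam := by
      rw [relIdem, smul_smul, mul_inv_cancel₀ (factorial_cast_ne_zero _), one_smul]
    rw [hF, smul_smul, ← Nat.cast_smul_eq_nsmul ℂ] at hsum
    have hDp := congrArg (fun b => ((labelledPartitions lam).card : ℂ)⁻¹ • b) hsum
    simp only [smul_smul, inv_mul_cancel₀ hc, one_smul] at hDp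
    have hav : ∑ σ : Equiv.Perm (Fin n), pull σ (relIdem lam * isotypic p.1 p.2) =
        (lam.parts.card.factorial : ℂ)⁻¹ • D p := by
      rw [relIdem_mul_isotypic hp]
      simp only [D, map_smul, map_sum, pull_isotypic, Finset.smul_sum, Function.comp_assoc]
    exact ⟨_, by rw [hav, hDp, smul_smul]⟩
  | zero => exact ⟨0, by simp⟩
  | add b b' _ _ hb hb' =>
    obtain ⟨c, hc⟩ := hb
    obtain ⟨c', hc'⟩ := hb'
    exact ⟨c + c', by simp only [mul_add, map_add, Finset.sum_add_distrib, hc, hc', add_smul]⟩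
  | smul r b _ hb =>
    obtain ⟨c, hc⟩ := hb
    exact ⟨r * c, by simp only [mul_smul_comm, map_smul, ← Finset.smul_sum, hc, mul_smul]⟩

end

end MantaciReutenauer

/-! ### Compositions and monotone maps -/

namespace MantaciReutenauer

open ColoredRel

section Composition

variable {n : ℕ}

theorem index_eq_iff (c : Composition n) (v : Fin n) (i : Fin c.length) :
    c.index v = i ↔ c.sizeUpTo i ≤ v ∧ (v : ℕ) < c.sizeUpTo (i + 1) := by
  rw [← c.mem_range_embedding_iff, c.mem_range_embedding_iff', eq_comm]

theorem lt_sizeUpTo_iff (c : Composition n) (v : Fin n) (i : ℕ) :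
    (v : ℕ) < c.sizeUpTo i ↔ (c.index v : ℕ) < i := by
  constructor
  · intro h
    by_contra hcon
    exact absurd (c.sizeUpTo_index_le v)
      (not_le.2 (lt_of_lt_of_le h (c.monotone_sizeUpTo (not_lt.1 hcon))))
  · intro h
    exact lt_of_lt_of_le (c.lt_sizeUpTo_index_succ v) (c.monotone_sizeUpTo h)

theorem index_monotone (c : Composition n) : Monotone c.index := by
  intro v w h
  by_contra hcon
  have h1 := (lt_sizeUpTo_iff c w _).2 (not_le.1 hcon)
  have h2 := c.sizeUpTo_index_le v
  have h3 : (v : ℕ) ≤ w := h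
  omega

theorem index_surjective (c : Composition n) : Function.Surjective c.index := fun i =>
  ⟨c.embedding i ⟨0, c.one_le_blocksFun i⟩, c.index_embedding i _⟩

theorem card_index_fiber (c : Composition n) (i : Fin c.length) :
    (Finset.univ.filter fun v => c.index v = i).card = c.blocksFun i := by
  have h : (Finset.univ.filter fun v => c.index v = i) =
      Finset.univ.map (c.embedding i).toEmbedding := by
    ext v
    have := c.mem_range_embedding_iff' (j := v) (i := i)
    simp only [Finset.mem_filter, Finset.mem_univ, true_and, Finset.mem_map]
    rw [eq_comm, ← this]
    rfl
  rw [h, Finset.card_map, Finset.card_univ, Fintype.card_fin]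

/-- Compositions correspond to monotone surjections. -/
theorem exists_composition {k : ℕ} {x : Fin n → Fin k} (hx : Monotone x)
    (hs : Function.Surjective x) :
    ∃ (c : Composition n) (h : c.length = k), ∀ v, x v = Fin.cast h (c.index v) := by
  classical
  let c : Composition n :=
    { blocks := List.ofFn fun i => (Finset.univ.filter fun v => x v = i).card
      blocks_pos := by
        intro b hb
        obtain ⟨i, rfl⟩ := (List.mem_ofFn' _ _).1 hb
        obtain ⟨v, hv⟩ := hs i
        exact Finset.card_pos.2 ⟨v, Finset.mem_filter.2 ⟨Finset.mem_univ _, hv⟩⟩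
      blocks_sum := by
        rw [List.sum_ofFn,
          ← Finset.card_eq_sum_card_fiberwise fun v _ => Finset.mem_coe.2 (Finset.mem_univ (x v)),
          Finset.card_univ, Fintype.card_fin] }
  have hc : c.length = k := by simp [c, Composition.length]
  have hsize : ∀ j, j ≤ k → c.sizeUpTo j = (Finset.univ.filter fun v => (x v : ℕ) < j).card := by
    intro j
    induction j with
    | zero => simp
    | succ j ih =>
      intro hj
      rw [c.sizeUpTo_succ (by omega : j < c.length), ih (by omega)]
      have hb : c.blocks[j]'(by rw [c.blocks_length]; omega) =
          (Finset.univ.filter fun v => x v = ⟨j, hj⟩).card := by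
        simp [c]
      rw [hb, ← Finset.card_union_of_disjoint]
      · congr 1
        ext v
        simp only [Finset.mem_union, Finset.mem_filter, Finset.mem_univ, true_and, Fin.ext_iff]
        omega
      · rw [Finset.disjoint_filter]
        intro v _ h1 h2
        rw [h2] at h1
        exact lt_irrefl _ h1
  refine ⟨c, hc, fun v => ?_⟩
  have h1 : c.index v = Fin.cast hc.symm (x v) := by
    rw [index_eq_iff]
    simp only [Fin.val_cast]
    constructor
    · rw [hsize _ (x v).2.le]
      calc _ ≤ (Finset.Iio v).card := Finset.card_le_card fun w hw => by
            rw [Finset.mem_Iio]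
            by_contra hcon
            exact absurd (Finset.mem_filter.1 hw).2 (not_lt.2 (hx (not_lt.1 hcon)))
        _ = v := by simp
    · rw [hsize _ (x v).2]
      calc (v : ℕ) < (Finset.Iic v).card := by simp
        _ ≤ _ := Finset.card_le_card fun w hw => by
            refine Finset.mem_filter.2 ⟨Finset.mem_univ _, Nat.lt_succ_of_le ?_⟩
            exact hx (Finset.mem_Iic.1 hw)
  rw [h1]
  rfl

theorem mem_boundaries_iff (c : Composition n) (b : Fin (n + 1)) :
    b ∈ c.boundaries ↔
      ∀ v w : Fin n, (v : ℕ) < b → (b : ℕ) ≤ w → c.index v < c.index w := by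
  have hmem : b ∈ c.boundaries ↔ ∃ i : Fin (c.length + 1), c.sizeUpTo i = b := by
    simp only [Composition.boundaries, Finset.mem_map, Finset.mem_univ, true_and]
    exact exists_congr fun i => Fin.ext_iff
  rw [hmem]
  constructor
  · rintro ⟨i, hi⟩ v w hv hw
    rw [← hi] at hv hw
    have h1 := (lt_sizeUpTo_iff c v i).1 hv
    have h2 := (lt_sizeUpTo_iff c w i).not.1 (not_lt.2 hw)
    exact Fin.lt_def.2 (by omega)
  · intro h
    rcases Nat.lt_or_ge b n with hb | hb
    · refine ⟨(c.index ⟨b, hb⟩).castSucc, ?_⟩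
      refine le_antisymm (c.sizeUpTo_index_le ⟨b, hb⟩) (not_lt.1 fun hlt => ?_)
      rw [Fin.val_castSucc] at hlt
      have hb1 : (b : ℕ) - 1 < n := by omega
      have h1 := h ⟨b - 1, hb1⟩ ⟨b, hb⟩ (by simp only; omega) le_rfl
      have h2 : c.index ⟨b - 1, hb1⟩ = c.index ⟨b, hb⟩ := by
        rw [index_eq_iff]
        have h3 := c.lt_sizeUpTo_index_succ ⟨b, hb⟩
        dsimp only at h3 ⊢
        refine ⟨by omega, ?_⟩
        refine lt_of_le_of_lt (Nat.sub_le _ _) ?_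
        exact h3
      exact absurd h2 h1.ne
    · refine ⟨Fin.last _, ?_⟩
      rw [Fin.val_last, c.sizeUpTo_length]
      have := b.2
      omega

theorem boundaries_subset_iff (p q : Composition n) :
    p.boundaries ⊆ q.boundaries ↔ ∀ v w, q.index v = q.index w → p.index v = p.index w := by
  constructor
  · intro h
    have key : ∀ v w, v ≤ w → q.index v = q.index w → p.index v = p.index w := by
      intro v w hvw hq
      refine le_antisymm (index_monotone p hvw) (not_lt.1 fun hlt => ?_)
      have hb : (⟨p.sizeUpTo (p.index w), Nat.lt_succ_of_le (p.sizeUpTo_le _)⟩ : Fin (n + 1)) ∈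
          p.boundaries := by
        rw [mem_boundaries_iff]
        intro a b ha hb
        have h1 := (lt_sizeUpTo_iff p a _).1 ha
        have h2 := (lt_sizeUpTo_iff p b (p.index w)).not.1 (not_lt.2 hb)
        exact Fin.lt_def.2 (by omega)
      have := (mem_boundaries_iff q _).1 (h hb) v w ((lt_sizeUpTo_iff p v _).2 hlt)
        (p.sizeUpTo_index_le w)
      exact this.ne hq
    intro v w hq
    rcases le_total v w with hvw | hvw
    · exact key v w hvw hq
    · exact (key w v hvw hq.symm).symm
  · intro h b hb
    rw [mem_boundaries_iff] at hb ⊢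
    intro v w hv hw
    have hvw : v ≤ w := Fin.le_def.2 (by omega)
    exact lt_of_le_of_ne (index_monotone q hvw) fun e => (hb v w hv hw).ne (h v w e)

theorem composition_eq_of_boundaries {p q : Composition n} (h : p.boundaries = q.boundaries) :
    p = q := by
  refine (compositionEquiv n).injective (CompositionAsSet.ext ?_)
  exact h

end Composition

section ColoredComposition

variable {A : Type*} {n : ℕ}

theorem le_iff_index {p q : ColoredComposition A n} :
    p ≤ q ↔ (∀ v w, q.comp.index v = q.comp.index w → p.comp.index v = p.comp.index w) ∧
      ∀ v, p.labelAt v = q.labelAt v :=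
  and_congr (boundaries_subset_iff _ _) Iff.rfl

theorem coloredComposition_ext {p q : ColoredComposition A n} (h : p.comp = q.comp)
    (h' : ∀ v, p.labelAt v = q.labelAt v) : p = q := by
  obtain ⟨c, f⟩ := p
  obtain ⟨d, g⟩ := q
  dsimp only at h
  subst h
  congr 1
  funext i
  obtain ⟨v, rfl⟩ := index_surjective c i
  exact h' v

theorem coloredComposition_antisymm {p q : ColoredComposition A n} (h : p ≤ q) (h' : q ≤ p) :
    p = q :=
  coloredComposition_ext (composition_eq_of_boundaries (h.1.antisymm h'.1)) h.2

/-- The face of a colored composition: the blocks are intervals of consecutive elements. -/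
def intervalFace (p : ColoredComposition A n) : ColoredRel (Fin n) A :=
  ofFun p.comp.index p.labelAt

theorem isFace_intervalFace (p : ColoredComposition A n) : (intervalFace p).IsFace :=
  isFace_ofFun fun _ _ h => congrArg p.label h

theorem intervalFace_injective :
    Function.Injective (intervalFace : ColoredComposition A n → ColoredRel (Fin n) A) := by
  intro p q h
  rw [ext_iff'] at h
  have h1 : ∀ v w, p.comp.index v = p.comp.index w ↔ q.comp.index v = q.comp.index w := by
    intro v w
    rw [le_antisymm_iff, le_antisymm_iff]
    exact and_congr (h.1 v w) (h.1 w v)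
  exact coloredComposition_antisymm (le_iff_index.2 ⟨fun v w => (h1 v w).2, h.2⟩)
    (le_iff_index.2 ⟨fun v w => (h1 v w).1, fun v => (h.2 v).symm⟩)

theorem exists_intervalFace {y : ColoredRel (Fin n) A} (hy : y.IsFace)
    (hmono : ∀ v w, v ≤ w → y.le v w) : ∃ p, y = intervalFace p := by
  obtain ⟨k, f, c, hf, rfl⟩ := hy.exists_ofFun
  obtain ⟨d, rfl, hd⟩ := exists_composition (fun v w h => hmono v w h) hf
  refine ⟨⟨d, c⟩, ?_⟩
  have : f = d.index := funext hd
  subst this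
  rfl

theorem isCompatible_iff {p : ColoredComposition A n} {w : ColoredPerm A n} :
    IsCompatible p w ↔
      (∀ i j, i < j → p.comp.index i = p.comp.index j → w.perm i < w.perm j) ∧
        ∀ i, w.color i = p.labelAt i := by
  constructor
  · intro h
    refine ⟨fun i j hij he => ?_, fun i => ?_⟩
    · have key : ∀ b (hb : p.comp.index i = b) (hb' : p.comp.index j = b), w.perm i < w.perm j := by
        intro b hb hb'
        obtain ⟨k, hk⟩ := p.comp.mem_range_embedding_iff'.2 hb.symm
        obtain ⟨l, hl⟩ := p.comp.mem_range_embedding_iff'.2 hb'.symm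
        rw [← hk, ← hl] at hij ⊢
        exact (h b).1 ((p.comp.embedding b).lt_iff_lt.1 hij)
      exact key _ he rfl
    · have := (h (p.comp.index i)).2 (p.comp.invEmbedding i)
      rwa [p.comp.embedding_comp_inv] at this
  · rintro ⟨h1, h2⟩ b
    refine ⟨fun k l hkl => h1 _ _ ((p.comp.embedding b).lt_iff_lt.2 hkl) ?_, fun k => ?_⟩
    · rw [p.comp.index_embedding, p.comp.index_embedding]
    · rw [h2, ColoredComposition.labelAt, p.comp.index_embedding]

theorem IsCompatible.mono {p q : ColoredComposition A n} {w : ColoredPerm A n}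
    (h : IsCompatible p w) (hpq : p ≤ q) : IsCompatible q w := by
  rw [isCompatible_iff] at h ⊢
  rw [le_iff_index] at hpq
  exact ⟨fun i j hij he => h.1 i j hij (hpq.1 i j he), fun i => (h.2 i).trans (hpq.2 i)⟩

/-- Every colored permutation has a coarsest compatible colored composition: its blocks are
separated by the descents and the changes of color. -/
theorem exists_isCo (w : ColoredPerm A n) : ∃ p, IsCo w p := by
  classical
  let isBreak : Fin n → Prop := fun b =>
    ∃ a : Fin n, (a : ℕ) + 1 = b ∧ (w.perm b < w.perm a ∨ w.color a ≠ w.color b)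
  let f : Fin n → ℕ := fun i => (Finset.univ.filter fun b => b ≤ i ∧ isBreak b).card
  have hf : Monotone f := by
    intro i j hij
    refine Finset.card_le_card fun b hb => ?_
    rw [Finset.mem_filter] at hb ⊢
    exact ⟨hb.1, hb.2.1.trans hij, hb.2.2⟩
  have hbreak : ∀ i b : Fin n, i < b → isBreak b → f i < f b := by
    intro i b hib hb
    refine Finset.card_lt_card (Finset.ssubset_iff_of_subset ?_ |>.2 ⟨b, ?_, ?_⟩)
    · intro a ha
      rw [Finset.mem_filter] at ha ⊢
      exact ⟨ha.1, ha.2.1.trans hib.le, ha.2.2⟩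
    · exact Finset.mem_filter.2 ⟨Finset.mem_univ _, le_rfl, hb⟩
    · intro h
      exact absurd (Finset.mem_filter.1 h).2.1 (not_le.2 hib)
  -- between two elements with the same value of `f` there is no break
  have hsame : ∀ (m : ℕ) (i j : Fin n), (i : ℕ) + m = j → f i = f j →
      w.perm i ≤ w.perm j ∧ w.color i = w.color j := by
    intro m
    induction m with
    | zero =>
      intro i j hij _
      have : i = j := Fin.ext hij
      rw [this]
      exact ⟨le_rfl, rfl⟩
    | succ m ih =>
      intro i j hij he
      have hj := j.2
      let j' : Fin n := ⟨i + m, by omega⟩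
      have hj' : (j' : ℕ) = i + m := rfl
      have h1 : f i ≤ f j' := hf (Fin.le_def.2 (by omega))
      have h2 : f j' ≤ f j := hf (Fin.le_def.2 (by omega))
      obtain ⟨h3, h4⟩ := ih i j' rfl (le_antisymm h1 (h2.trans he.ge))
      have hnb : ¬ isBreak j := fun hb => by
        have := hbreak j' j (Fin.lt_def.2 (by omega)) hb
        omega
      simp only [isBreak, not_exists, not_and, not_or, not_lt, not_not] at hnb
      obtain ⟨h5, h6⟩ := hnb j' (by omega)
      exact ⟨h3.trans h5, h4.trans h6⟩
  have hsame' : ∀ i j : Fin n, i ≤ j → f i = f j → w.perm i ≤ w.perm j ∧ w.color i = w.color j :=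
    fun i j hij he => hsame (j - i) i j (by have := Fin.le_def.1 hij; omega) he
  obtain ⟨p, hp⟩ := exists_intervalFace (y := ofFun f w.color) (isFace_ofFun fun i j he => by
    rcases le_total i j with h | h
    · exact (hsame' i j h he).2
    · exact (hsame' j i h he.symm).2.symm) (fun v w h => hf h)
  rw [ext_iff'] at hp
  have hpf : ∀ i j, p.comp.index i = p.comp.index j ↔ f i = f j := by
    intro i j
    rw [le_antisymm_iff, le_antisymm_iff]
    exact (and_congr (hp.1 i j) (hp.1 j i)).symm
  refine ⟨p, isCompatible_iff.2 ⟨fun i j hij he => ?_, hp.2⟩, fun q hq => le_iff_index.2 ⟨?_, ?_⟩⟩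
  · exact lt_of_le_of_ne (hsame' i j hij.le ((hpf i j).1 he)).1
      fun h => hij.ne (w.perm.injective h)
  · rw [isCompatible_iff] at hq
    have key : ∀ i j, i ≤ j → q.comp.index i = q.comp.index j → f i = f j := by
      intro i j hij he
      have : (Finset.univ.filter fun b => b ≤ j ∧ isBreak b) ⊆
          (Finset.univ.filter fun b => b ≤ i ∧ isBreak b) := by
        intro b hb
        rw [Finset.mem_filter] at hb ⊢
        refine ⟨hb.1, ?_, hb.2.2⟩
        by_contra hib
        obtain ⟨a, hab, hbr⟩ := hb.2.2
        have hia : i ≤ a := Fin.le_def.2 (by have := Fin.lt_def.1 (not_le.1 hib); omega)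
        have hab' : a < b := Fin.lt_def.2 (by omega)
        have e1 : q.comp.index a = q.comp.index b := by
          apply le_antisymm (index_monotone _ hab'.le)
          calc q.comp.index b ≤ q.comp.index j := index_monotone _ hb.2.1
            _ = q.comp.index i := he.symm
            _ ≤ q.comp.index a := index_monotone _ hia
        rcases hbr with h | h
        · exact absurd (hq.1 a b hab' e1) (not_lt.2 h.le)
        · refine h ?_
          rw [hq.2, hq.2]
          exact congrArg q.label e1
      exact le_antisymm (hf hij) (Finset.card_le_card this)
    intro i j he
    rw [hpf]
    rcases le_total i j with h | h
    · exact key i j h he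
    · exact (key j i h he.symm).symm
  · intro i
    exact (hp.2 i).symm.trans ((isCompatible_iff.1 hq).2 i)

end ColoredComposition

end MantaciReutenauer

/-! ### Chambers and the Mantaci–Reutenauer algebra -/

namespace MantaciReutenauer

open ColoredRel

section

variable {G : Type*} {n : ℕ}

/-- The chamber of a colored permutation in one-line notation: the elements are ordered as they
appear in the word and carry the color of their position. -/
def chamber (w : ColoredPerm G n) : ColoredRel (Fin n) G :=
  ofFun w.perm.symm (w.color ∘ w.perm.symm)

theorem chamber_injective : Function.Injective (chamber : ColoredPerm G n → _) := by
  rintro ⟨σ, g⟩ ⟨τ, h⟩ e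
  rw [chamber, chamber, ext_iff'] at e
  obtain ⟨h1, h2⟩ := e
  have hm : Monotone (τ.trans σ.symm) := by
    intro i j hij
    refine (h1 (τ i) (τ j)).2 ?_
    simpa [ofFun] using hij
  have hτ : τ.trans σ.symm = 1 := (Equiv.Perm.monotone_iff _).1 hm
  have hστ : σ = τ := by
    ext i
    have := congrArg σ (DFunLike.congr_fun hτ i)
    simp only [Equiv.trans_apply, Equiv.apply_symm_apply, Equiv.Perm.one_apply] at this
    rw [this]
  subst hστ
  congr 1
  funext i
  simpa [ofFun] using h2 (σ i)

variable [CommGroup G]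

/-- The product of a face with the chamber of the identity is the chamber of `w` if and only if
`w` relabels the face to an interval face compatible with `w`. -/
theorem comap_intervalFace_mul_chamber_one {q : ColoredComposition G n} {w : ColoredPerm G n}
    (h : IsCompatible q w) :
    comap w.perm.symm (intervalFace q) * chamber 1 = chamber w := by
  rw [isCompatible_iff] at h
  refine ext_iff'.2 ⟨fun i j => ?_, fun i => ?_⟩
  · obtain ⟨a, rfl⟩ := w.perm.surjective i
    obtain ⟨b, rfl⟩ := w.perm.surjective j
    simp only [mul_le, comap_le, intervalFace, ofFun, chamber, Equiv.symm_apply_apply,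
      ColoredPerm.one_def]
    change (_ ∧ (_ → w.perm a ≤ w.perm b)) ↔ _
    constructor
    · rintro ⟨h1, h2⟩
      by_contra hab
      have h3 := le_antisymm h1 (index_monotone _ (not_le.1 hab).le)
      exact absurd (h.1 b a (not_le.1 hab) h3.symm) (not_lt.2 (h2 h3.ge))
    · intro hab
      refine ⟨index_monotone _ hab, fun h2 => ?_⟩
      rcases hab.lt_or_eq with h3 | h3
      · exact (h.1 a b h3 (le_antisymm (index_monotone _ hab) h2)).le
      · rw [h3]
  · change q.labelAt (w.perm.symm i) * 1 = w.color (w.perm.symm i)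
    rw [mul_one, h.2]

theorem exists_comap_intervalFace {y : ColoredRel (Fin n) G} (hy : y.IsFace) :
    ∃ (q : ColoredComposition G n) (w : ColoredPerm G n),
      IsCompatible q w ∧ comap w.perm.symm (intervalFace q) = y := by
  obtain ⟨k, f, c, -, rfl⟩ := hy.exists_ofFun
  obtain ⟨σ, hσ, hlex⟩ := exists_perm_lex f (q := id) Function.injective_id
  have hface : (comap σ (ofFun f (c ∘ f))).IsFace := hy.comap σ
  obtain ⟨q, hq⟩ := exists_intervalFace hface fun v w h => hσ h
  refine ⟨q, ⟨σ, (c ∘ f) ∘ σ⟩, isCompatible_iff.2 ⟨fun i j hij he => ?_, fun i => ?_⟩, ?_⟩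
  · rw [ext_iff'] at hq
    have h1 : f (σ i) = f (σ j) := le_antisymm ((hq.1 i j).2 he.le) ((hq.1 j i).2 he.ge)
    have h2 := (hlex (σ i) (σ j)).2 (by simpa using hij.le)
    rw [Prod.Lex.toLex_le_toLex] at h2
    rcases h2 with h2 | ⟨-, h2⟩
    · exact absurd h1 h2.ne
    · exact lt_of_le_of_ne h2 fun h => hij.ne (σ.injective h)
  · exact (ext_iff'.1 hq).2 i
  · rw [← hq]
    refine ext_iff'.2 ⟨fun i j => ?_, fun i => ?_⟩
    · simp [comap_le]
    · simp [comap_color]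

theorem comap_intervalFace_injOn {q q' : ColoredComposition G n} {w w' : ColoredPerm G n}
    (h : IsCompatible q w) (h' : IsCompatible q' w')
    (e : comap w.perm.symm (intervalFace q) = comap w'.perm.symm (intervalFace q')) :
    q = q' ∧ w = w' := by
  have hw : w = w' := chamber_injective (by
    rw [← comap_intervalFace_mul_chamber_one h, e, comap_intervalFace_mul_chamber_one h'])
  subst hw
  refine ⟨intervalFace_injective ?_, rfl⟩
  refine ext_iff'.2 ⟨fun i j => ?_, fun i => ?_⟩
  · simpa [comap_le] using (ext_iff'.1 e).1 (w.perm i) (w.perm j)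
  · simpa [comap_color] using (ext_iff'.1 e).2 (w.perm i)

/-- The embedding of the group algebra as the span of the chambers. -/
noncomputable def toChambers : GroupAlg G n →ₗ[ℂ] RelAlg (Fin n) G :=
  MonoidAlgebra.mapDomainLinearMap ℂ ℂ chamber

theorem toChambers_of (w : ColoredPerm G n) :
    toChambers (MonoidAlgebra.of ℂ (ColoredPerm G n) w) = δ (chamber w) := by
  simp [toChambers]

theorem toChambers_injective : Function.Injective (toChambers : GroupAlg G n → _) := by
  intro a b h
  exact MonoidAlgebra.mapDomain_injective chamber_injective h

/-- The left action of the wreath product on colored relations. -/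
def relabel (v : ColoredPerm G n) (y : ColoredRel (Fin n) G) : ColoredRel (Fin n) G :=
  ⟨(comap v.perm.symm y).le, fun j => v.color (v.perm.symm j) * y.color (v.perm.symm j)⟩

theorem relabel_chamber (v w : ColoredPerm G n) : relabel v (chamber w) = chamber (v * w) := by
  refine ext_iff'.2 ⟨fun i j => ?_, fun i => ?_⟩
  · exact Iff.rfl
  · change v.color (v.perm.symm i) * w.color (w.perm.symm (v.perm.symm i)) =
      v.color (w.perm (w.perm.symm (v.perm.symm i))) * w.color (w.perm.symm (v.perm.symm i))
    rw [Equiv.apply_symm_apply]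

/-- Since `G` is commutative, relabelling commutes with the products by faces, up to the permutation
of the ground set. -/
theorem relabel_mul (v : ColoredPerm G n) (y z : ColoredRel (Fin n) G) :
    relabel v (y * z) = comap v.perm.symm y * relabel v z :=
  ext_iff'.2 ⟨fun _ _ => Iff.rfl, fun _ => mul_left_comm _ _ _⟩

/-- Left multiplication by the wreath product commutes with the invariants of the symmetric
group. -/
theorem toChambers_mul {a : RelAlg (Fin n) G} (ha : a ∈ faceInvariants G n) {A : GroupAlg G n}
    (hA : toChambers A = a * δ (chamber 1)) (B : GroupAlg G n) :
    toChambers (B * A) = a * toChambers B := by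
  induction B using MonoidAlgebra.induction_on with
  | of v =>
    let L : RelAlg (Fin n) G →ₗ[ℂ] RelAlg (Fin n) G :=
      MonoidAlgebra.mapDomainLinearMap ℂ ℂ (relabel v)
    have hL : ∀ y, L (δ y) = δ (relabel v y) := fun y => by simp [L]
    have h1 : ∀ A : GroupAlg G n,
        toChambers (MonoidAlgebra.of ℂ (ColoredPerm G n) v * A) = L (toChambers A) := by
      intro A
      induction A using MonoidAlgebra.induction_on with
      | of w => rw [← map_mul, toChambers_of, toChambers_of, hL, relabel_chamber]
      | add A A' h h' => rw [mul_add, map_add, map_add, map_add, h, h']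
      | smul r A h => rw [mul_smul_comm, map_smul, map_smul, map_smul, h]
    have h2 : ∀ (b : RelAlg (Fin n) G) (z : ColoredRel (Fin n) G),
        L (b * δ z) = pull v.perm.symm b * δ (relabel v z) := by
      intro b z
      induction b using MonoidAlgebra.induction_on with
      | of y =>
        have h3 := pull_δ v.perm.symm y
        rw [δ] at h3
        rw [h3, ← map_mul, ← map_mul, hL, relabel_mul]
      | add b b' h h' => rw [add_mul, map_add, map_add, add_mul, h, h']
      | smul r b h => rw [smul_mul_assoc, map_smul, map_smul, smul_mul_assoc, h]
    rw [h1, hA, h2, ha.2, relabel_chamber, mul_one, toChambers_of]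
  | add B B' h h' => rw [add_mul, map_add, map_add, mul_add, h, h']
  | smul r B h => rw [smul_mul_assoc, map_smul, map_smul, mul_smul_comm, h]

theorem comap_intervalFace_eq {p q : ColoredComposition G n} {σ : Equiv.Perm (Fin n)}
    (h : comap σ (intervalFace p) = intervalFace q) : p = q := by
  refine intervalFace_injective (Eq.trans ?_ h)
  have hm : Monotone (p.comp.index ∘ σ) := fun i j hij =>
    ((ext_iff'.1 h).1 i j).2 (index_monotone _ hij)
  have e := Tuple.unique_monotone (σ := σ) (τ := 1) hm (index_monotone _)
  have e' : ∀ i, p.comp.index (σ i) = p.comp.index i := congrFun e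
  refine ext_iff'.2 ⟨fun i j => ?_, fun i => ?_⟩
  · simp only [comap_le, intervalFace, ofFun, e']
  · exact congrArg p.label (e' i).symm

variable [Finite G]

open scoped Classical in
/-- `X p` is the sum of all `(σ, g)` which are compatible with `p`. -/
theorem X_eq (p : ColoredComposition G n) :
    X p = ∑ w : ColoredPerm G n with IsCompatible p w, MonoidAlgebra.of ℂ (ColoredPerm G n) w := by
  have hY : ∀ q : ColoredComposition G n, Y q =
      ∑ w, if IsCo w q then MonoidAlgebra.of ℂ (ColoredPerm G n) w else 0 :=
    fun q => Finset.sum_filter _ _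
  rw [X, Finset.sum_congr rfl fun q _ => hY q, Finset.sum_comm, Finset.sum_filter]
  refine Finset.sum_congr rfl fun w _ => ?_
  obtain ⟨q, hq⟩ := exists_isCo w
  have huniq : ∀ q', IsCo w q' → q' = q := fun q' hq' =>
    coloredComposition_antisymm (hq'.2 q hq.1) (hq.2 q' hq'.1)
  split_ifs with hp
  · rw [Finset.sum_eq_single q, if_pos hq]
    · intro q' _ hne
      exact if_neg fun h => hne (huniq q' h)
    · intro h
      exact (h (Finset.mem_filter.2 ⟨Finset.mem_univ _, hq.2 p hp⟩)).elim
  · refine Finset.sum_eq_zero fun q' hq' => if_neg fun h => hp ?_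
    exact h.1.mono (Finset.mem_filter.1 hq').2

theorem X_mem_mrSubmodule (p : ColoredComposition G n) : X p ∈ mrSubmodule G n :=
  Submodule.sum_mem _ fun q _ => Submodule.subset_span ⟨q, rfl⟩

/-- The relation between the `X p` and the `Y p` is unitriangular. -/
theorem Y_mem_span_X (p : ColoredComposition G n) :
    Y p ∈ Submodule.span ℂ (Set.range (X : ColoredComposition G n → GroupAlg G n)) := by
  classical
  induction hN : p.comp.boundaries.card using Nat.strong_induction_on generalizing p with
  | _ N ih =>
    have h : Y p = X p - ∑ q ∈ (Finset.univ.filter fun q => q ≤ p).erase p, Y q := by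
      rw [eq_sub_iff_add_eq, Finset.add_sum_erase]
      · rw [X]
      · exact Finset.mem_filter.2 ⟨Finset.mem_univ _, subset_rfl, fun _ => rfl⟩
    rw [h]
    refine Submodule.sub_mem _ (Submodule.subset_span ⟨p, rfl⟩) (Submodule.sum_mem _ fun q hq => ?_)
    rw [Finset.mem_erase, Finset.mem_filter] at hq
    refine ih _ ?_ q rfl
    rw [← hN]
    refine Finset.card_lt_card (hq.2.2.1.ssubset_of_ne fun e => hq.1 ?_)
    exact coloredComposition_ext (composition_eq_of_boundaries e) hq.2.2.2

/-- The linear map reading off the coefficients of the interval faces; on the invariants of the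
symmetric group it is an anti-homomorphism to the group algebra (`toGroupAlg_mul`). -/
noncomputable def toGroupAlg : RelAlg (Fin n) G →ₗ[ℂ] GroupAlg G n where
  toFun a := ∑ q : ColoredComposition G n, a.coeff (intervalFace q) • X q
  map_add' a b := by
    simp only [MonoidAlgebra.coeff_add, Finsupp.add_apply, add_smul, Finset.sum_add_distrib]
  map_smul' c a := by
    simp only [MonoidAlgebra.coeff_smul_apply, smul_assoc, Finset.smul_sum, RingHom.id_apply]

theorem toGroupAlg_apply (a : RelAlg (Fin n) G) :
    toGroupAlg a = ∑ q : ColoredComposition G n, a.coeff (intervalFace q) • X q := rfl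

theorem eq_sum_coeff (a : RelAlg (Fin n) G) : a = ∑ y, a.coeff y • δ y := by
  classical
  ext z
  rw [MonoidAlgebra.coeff_sum, Finsupp.finsetSum_apply]
  simp only [MonoidAlgebra.coeff_smul_apply, coeff_δ]
  simp

/-- On invariants, `toGroupAlg` is the action on the chamber of the identity: every face is uniquely
a relabelled interval face `q`, by a permutation `w` compatible with `q`. -/
theorem toChambers_toGroupAlg {a : RelAlg (Fin n) G} (ha : a ∈ faceInvariants G n) :
    toChambers (toGroupAlg a) = a * δ (chamber 1) := by
  classical
  have hR : a * δ (chamber 1) = ∑ y ∈ Finset.univ.filter (fun y : ColoredRel (Fin n) G => y.IsFace),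
      a.coeff y • δ (y * chamber 1) := by
    conv_lhs => rw [eq_sum_coeff a]
    rw [Finset.sum_mul, Finset.sum_filter]
    refine Finset.sum_congr rfl fun y _ => ?_
    rw [smul_mul_assoc, ← map_mul]
    split_ifs with h
    · rfl
    · rw [not_not.1 fun h' => h (isFace_of_coeff_ne_zero ha.1 h'), zero_smul]
  have hL : toChambers (toGroupAlg a) = ∑ p ∈ Finset.univ.filter
      (fun p : ColoredComposition G n × ColoredPerm G n => IsCompatible p.1 p.2),
      a.coeff (intervalFace p.1) • δ (chamber p.2) := by
    rw [toGroupAlg_apply, map_sum, Finset.sum_filter, Fintype.sum_prod_type]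
    refine Finset.sum_congr rfl fun q _ => ?_
    rw [map_smul, X_eq, map_sum, Finset.smul_sum, Finset.sum_filter]
    refine Finset.sum_congr rfl fun w _ => ?_
    rw [toChambers_of]
  rw [hL, hR]
  refine Finset.sum_bij (fun p _ => comap p.2.perm.symm (intervalFace p.1)) ?_ ?_ ?_ ?_
  · intro p _
    exact Finset.mem_filter.2 ⟨Finset.mem_univ _, (isFace_intervalFace _).comap _⟩
  · rintro ⟨q, w⟩ hp ⟨q', w'⟩ hp' e
    obtain ⟨h1, h2⟩ := comap_intervalFace_injOn (Finset.mem_filter.1 hp).2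
      (Finset.mem_filter.1 hp').2 e
    exact Prod.ext h1 h2
  · intro y hy
    obtain ⟨q, w, h, e⟩ := exists_comap_intervalFace (Finset.mem_filter.1 hy).2
    exact ⟨(q, w), Finset.mem_filter.2 ⟨Finset.mem_univ _, h⟩, e⟩
  · intro p hp
    rw [coeff_comap_of_mem ha, comap_intervalFace_mul_chamber_one (Finset.mem_filter.1 hp).2]

theorem toGroupAlg_mul {a b : RelAlg (Fin n) G} (ha : a ∈ faceInvariants G n)
    (hb : b ∈ faceInvariants G n) : toGroupAlg a * toGroupAlg b = toGroupAlg (b * a) := by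
  refine toChambers_injective ?_
  rw [toChambers_mul hb (toChambers_toGroupAlg hb), toChambers_toGroupAlg ha,
    toChambers_toGroupAlg ((faceInvariants G n).mul_mem hb ha), mul_assoc]

theorem toGroupAlg_one : toGroupAlg (1 : RelAlg (Fin n) G) = 1 := by
  refine toChambers_injective ?_
  rw [toChambers_toGroupAlg (faceInvariants G n).one_mem, one_mul,
    ← map_one (MonoidAlgebra.of ℂ (ColoredPerm G n)), toChambers_of]

/-- The preimage is a multiple of the sum of all permutations of the interval face of `p`. -/
theorem exists_toGroupAlg_eq_X (p : ColoredComposition G n) :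
    ∃ a ∈ faceInvariants G n, toGroupAlg a = X p := by
  classical
  set a := ∑ σ : Equiv.Perm (Fin n), pull σ (δ (intervalFace p)) with ha
  have hmem : a ∈ faceInvariants G n := sum_pull_mem (δ_mem_faceSpan (isFace_intervalFace p))
  have hcoeff : ∀ q, a.coeff (intervalFace q) =
      ((Finset.univ.filter fun σ : Equiv.Perm (Fin n) =>
        comap σ (intervalFace p) = intervalFace q).card : ℂ) := by
    intro q
    rw [ha, MonoidAlgebra.coeff_sum, Finsupp.finsetSum_apply, Finset.card_filter, Nat.cast_sum]
    refine Finset.sum_congr rfl fun σ _ => ?_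
    rw [pull_δ, coeff_δ, Nat.cast_ite, Nat.cast_one, Nat.cast_zero]
  have h0 : a.coeff (intervalFace p) ≠ 0 := by
    rw [hcoeff]
    have : (1 : Equiv.Perm (Fin n)) ∈ Finset.univ.filter fun σ : Equiv.Perm (Fin n) =>
        comap σ (intervalFace p) = intervalFace p := Finset.mem_filter.2 ⟨Finset.mem_univ _, rfl⟩
    exact_mod_cast Finset.card_ne_zero_of_mem this
  refine ⟨(a.coeff (intervalFace p))⁻¹ • a, (faceInvariants G n).smul_mem hmem _, ?_⟩
  rw [map_smul, toGroupAlg_apply, Finset.sum_eq_single p, smul_smul, inv_mul_cancel₀ h0, one_smul]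
  · intro q _ hq
    rw [hcoeff, Finset.card_eq_zero.2, Nat.cast_zero, zero_smul]
    refine Finset.filter_eq_empty_iff.2 fun σ _ h => hq (comap_intervalFace_eq h).symm
  · simp

/-- The Mantaci–Reutenauer algebra, as the image of the algebra of invariants. -/
noncomputable def mrSubalgebra (G : Type*) [CommGroup G] [Finite G] (n : ℕ) :
    Subalgebra ℂ (GroupAlg G n) where
  carrier := {A | ∃ a ∈ faceInvariants G n, toGroupAlg a = A}
  mul_mem' := by
    rintro _ _ ⟨a, ha, rfl⟩ ⟨b, hb, rfl⟩
    exact ⟨b * a, (faceInvariants G n).mul_mem hb ha, (toGroupAlg_mul ha hb).symm⟩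
  add_mem' := by
    rintro _ _ ⟨a, ha, rfl⟩ ⟨b, hb, rfl⟩
    exact ⟨a + b, (faceInvariants G n).add_mem ha hb, map_add _ _ _⟩
  algebraMap_mem' c := ⟨c • 1, (faceInvariants G n).smul_mem (faceInvariants G n).one_mem c, by
    rw [map_smul, toGroupAlg_one, Algebra.algebraMap_eq_smul_one]⟩

theorem toSubmodule_mrSubalgebra :
    Subalgebra.toSubmodule (mrSubalgebra G n) = mrSubmodule G n := by
  apply le_antisymm
  · rintro _ ⟨a, -, rfl⟩
    exact Submodule.sum_mem _ fun q _ => Submodule.smul_mem _ _ (X_mem_mrSubmodule q)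
  · rw [mrSubmodule, Submodule.span_le]
    rintro _ ⟨p, rfl⟩
    have h : Submodule.span ℂ (Set.range (X : ColoredComposition G n → GroupAlg G n)) ≤
        Subalgebra.toSubmodule (mrSubalgebra G n) := by
      rw [Submodule.span_le]
      rintro _ ⟨q, rfl⟩
      exact exists_toGroupAlg_eq_X q
    exact h (Y_mem_span_X p)

end

end MantaciReutenauer

/-! ### The coefficients of the idempotents -/

namespace MantaciReutenauer

open ColoredRel

section

variable {n k : ℕ}

theorem prod_sum_linWeight_mul_choose (m : Fin k → ℕ) (hm : ∀ i, m i ≠ 0) (hmn : ∀ i, m i ≤ n) :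
    ∏ i, ∑ s ∈ Finset.range (n + 1), linWeight n s *
        ∏ j ∈ Finset.univ.filter (fun j => id j = i), (s.choose (m j) : ℂ) =
      ∏ i, (-1) ^ (m i - 1) / (m i : ℂ) := by
  refine Finset.prod_congr rfl fun i _ => ?_
  rw [← sum_linWeight_mul_choose (hm i) (hmn i)]
  refine Finset.sum_congr rfl fun s _ => ?_
  have : (Finset.univ.filter fun j : Fin k => id j = i) = {i} := by
    ext j
    simp
  rw [this, Finset.prod_singleton]

theorem card_image_fiber_ne_zero {x : Fin n → Fin k} (hx : Function.Surjective x) (h₀ : Fin n → ℕ)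
    (i : Fin k) : ((Finset.univ.filter fun v => x v = i).image h₀).card ≠ 0 := by
  obtain ⟨v, hv⟩ := hx i
  exact Finset.card_ne_zero_of_mem
    (Finset.mem_image_of_mem _ (Finset.mem_filter.2 ⟨Finset.mem_univ v, hv⟩))

theorem card_image_fiber_le (x : Fin n → Fin k) (h₀ : Fin n → ℕ) (i : Fin k) :
    ((Finset.univ.filter fun v => x v = i).image h₀).card ≤ n :=
  (Finset.card_image_le.trans (Finset.card_filter_le _ _)).trans (by simp)

open scoped Classical in
/-- The coefficient of an interval face in a product of first Eulerian idempotents. -/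
theorem coeff_intervalFace {G : Type*} [Monoid G] {x : Fin n → Fin k}
    (hx : Function.Surjective x) (c : Fin n → G) (q : ColoredComposition G n) :
    (δ (ofFun x c) * eulerian x).coeff (intervalFace q) =
      if c = q.labelAt ∧ ∀ v w, q.comp.index v ≤ q.comp.index w → x v ≤ x w then
        ∏ i, (-1) ^ (((Finset.univ.filter fun v => x v = i).image
          fun v => (q.comp.index v : ℕ)).card - 1) /
          (((Finset.univ.filter fun v => x v = i).image
            fun v => (q.comp.index v : ℕ)).card : ℂ) else 0 := by
  split_ifs with h
  · have hq : intervalFace q = ofFun x c * ofFun (fun v => (q.comp.index v : ℕ)) 1 := by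
      refine ext_iff'.2 ⟨fun v w => ?_, fun v => ?_⟩
      · change q.comp.index v ≤ q.comp.index w ↔
          x v ≤ x w ∧ (x w ≤ x v → q.comp.index v ≤ q.comp.index w)
        refine ⟨fun h' => ⟨h.2 v w h', fun _ => h'⟩, fun h' => ?_⟩
        rcases le_total (q.comp.index v) (q.comp.index w) with h'' | h''
        · exact h''
        · exact h'.2 (h.2 w v h'')
      · change q.labelAt v = c v * 1
        rw [mul_one, h.1]
    rw [hq]
    have := coeff_mul_eulerian x c id fun v => (q.comp.index v : ℕ)
    rw [Function.id_comp] at this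
    rw [this, prod_sum_linWeight_mul_choose _ (card_image_fiber_ne_zero hx _)
      (card_image_fiber_le x _)]
  · rw [mul_eulerian, MonoidAlgebra.coeff_sum, Finsupp.finsetSum_apply]
    refine Finset.sum_eq_zero fun t _ => ?_
    rw [MonoidAlgebra.coeff_smul_apply, MonoidAlgebra.coeff_sum, Finsupp.finsetSum_apply,
      Finset.sum_eq_zero, smul_zero]
    intro h' _
    rw [← map_mul, coeff_δ, if_neg]
    intro e
    rw [ext_iff'] at e
    refine h ⟨funext fun v => ?_, fun v w hvw => ((e.1 v w).2 hvw).1⟩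
    have := e.2 v
    rwa [mul_color, show (ofFun h' (1 : Fin n → G)).color v = 1 from rfl, mul_one] at this

/-- For a refinement, the map sending a block of the finer composition to the block of the coarser
one which contains it. -/
theorem exists_blockMap {p q : Composition n}
    (h : ∀ v w, q.index v = q.index w → p.index v = p.index w) :
    ∃ r : Fin q.length → Fin p.length, ∀ v, r (q.index v) = p.index v := by
  choose s hs using index_surjective q
  exact ⟨fun j => p.index (s j), fun v => h _ _ (hs _)⟩

theorem prod_eq_sign_div_deg {p q : Composition n}
    (h : ∀ v w, q.index v = q.index w → p.index v = p.index w) :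
    ∏ i, (-1) ^ (((Finset.univ.filter fun v => p.index v = i).image
          fun v => (q.index v : ℕ)).card - 1) /
          (((Finset.univ.filter fun v => p.index v = i).image
            fun v => (q.index v : ℕ)).card : ℂ) =
      (-1 : ℂ) ^ ((q.length : ℤ) - (p.length : ℤ)) / (q.deg p : ℂ) := by
  obtain ⟨r, hr⟩ := exists_blockMap h
  have hm : ∀ i, ((Finset.univ.filter fun v => p.index v = i).image
      fun v => (q.index v : ℕ)).card = (Finset.univ.filter fun j => r j = i).card := by
    intro i
    rw [← Finset.card_image_of_injective (Finset.univ.filter fun j => r j = i) Fin.val_injective]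
    congr 1
    ext m
    simp only [Finset.mem_image, Finset.mem_filter, Finset.mem_univ, true_and]
    constructor
    · rintro ⟨v, hv, rfl⟩
      exact ⟨q.index v, (hr v).trans hv, rfl⟩
    · rintro ⟨j, hj, rfl⟩
      obtain ⟨v, rfl⟩ := index_surjective q j
      exact ⟨v, (hr v).symm.trans hj, rfl⟩
  have hdeg : q.deg p = ∏ i, (Finset.univ.filter fun j => r j = i).card := by
    refine Finset.prod_congr rfl fun i _ => ?_
    congr 1
    ext j
    simp only [Finset.mem_filter, Finset.mem_univ, true_and, ← hr, q.index_embedding]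
    exact ⟨fun h' => h' ⟨0, q.one_le_blocksFun j⟩, fun h' _ => h'⟩
  have hone : ∀ i, 1 ≤ (Finset.univ.filter fun j => r j = i).card := by
    intro i
    obtain ⟨v, rfl⟩ := index_surjective p i
    exact Finset.card_pos.2 ⟨q.index v, Finset.mem_filter.2 ⟨Finset.mem_univ _, hr v⟩⟩
  have hsum : ∑ i, ((Finset.univ.filter fun j => r j = i).card - 1) + p.length = q.length := by
    have h1 : ∑ i, (Finset.univ.filter fun j => r j = i).card = q.length := by
      rw [← Finset.card_eq_sum_card_fiberwise fun j _ => Finset.mem_coe.2 (Finset.mem_univ (r j)),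
        Finset.card_univ, Fintype.card_fin]
    have h2 : ∑ i, (((Finset.univ.filter fun j => r j = i).card - 1) + 1) = q.length :=
      (Finset.sum_congr rfl fun i _ => Nat.sub_add_cancel (hone i)).trans h1
    rw [Finset.sum_add_distrib] at h2
    simpa using h2
  have hexp : (q.length : ℤ) - (p.length : ℤ) =
      ((∑ i, ((Finset.univ.filter fun j => r j = i).card - 1) : ℕ) : ℤ) := by
    omega
  rw [Finset.prod_div_distrib, hexp, zpow_natCast, hdeg, Nat.cast_prod,
    ← Finset.prod_pow_eq_pow_sum]
  simp only [hm]

end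

section

variable {G : Type*} [CommGroup G] {n : ℕ}

/-- The values of a character of a finite group are roots of unity. -/
theorem star_character [Finite G] (χ : G →* ℂˣ) (g : G) :
    starRingEnd ℂ (χ g : ℂˣ) = ((χ g⁻¹ : ℂˣ) : ℂ) := by
  have h : ((χ g : ℂˣ) : ℂ) ^ Nat.card G = 1 := by
    rw [← Units.val_pow_eq_pow_val, ← map_pow, pow_card_eq_one', map_one, Units.val_one]
  rw [map_inv, Units.val_inv_eq_inv_val,
    Complex.inv_eq_conj (Complex.norm_eq_one_of_pow_eq_one h Nat.card_pos.ne')]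

theorem star_evalChar [Finite G] (c : Composition n) (α : Fin c.length → G →* ℂˣ)
    (g : Fin c.length → G) : starRingEnd ℂ (evalChar ⟨c, α⟩ ⟨c, g⟩) = pairing α g⁻¹ := by
  rw [evalChar, dif_pos rfl, map_prod, pairing_apply]
  exact Finset.prod_congr rfl fun i _ => star_character _ _

theorem blockType_index {A : Type*} (c : Composition n) (α : Fin c.length → A) :
    blockType c.index α = (ColoredComposition.supp ⟨c, α⟩).parts := by
  simp only [blockType, card_index_fiber, ColoredComposition.supp]

theorem card_parts_supp {A : Type*} (α : ColoredComposition A n) :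
    α.supp.parts.card = α.comp.length := by
  simp [ColoredComposition.supp]

open scoped Classical in
theorem pairing_mul_coeff_intervalFace [Finite G] (c : Composition n) (α : Fin c.length → G →* ℂˣ)
    (g : Fin c.length → G) (q : ColoredComposition G n) {k : ℕ} (h : c.length = k) :
    pairing (α ∘ Fin.cast h.symm) (g ∘ Fin.cast h.symm)⁻¹ *
      (δ (ofFun (Fin.cast h ∘ c.index) ((g ∘ Fin.cast h.symm) ∘ Fin.cast h ∘ c.index)) *
        eulerian (Fin.cast h ∘ c.index)).coeff (intervalFace q) =
      starRingEnd ℂ (evalChar ⟨c, α⟩ ⟨c, g⟩) *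
        if (⟨c, g⟩ : ColoredComposition G n) ≤ q then
          (-1 : ℂ) ^ ((q.comp.length : ℤ) - (c.length : ℤ)) / (q.comp.deg c : ℂ) else 0 := by
  subst h
  rw [star_evalChar]
  congr 1
  refine (coeff_intervalFace (index_surjective c) (g ∘ c.index) q).trans ?_
  have hiff : (g ∘ c.index = q.labelAt ∧
      ∀ v w, q.comp.index v ≤ q.comp.index w → c.index v ≤ c.index w) ↔
      (⟨c, g⟩ : ColoredComposition G n) ≤ q := by
    rw [le_iff_index, and_comm]
    refine and_congr ⟨fun h v w e => le_antisymm (h v w e.le) (h w v e.ge), fun h v w e => ?_⟩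
      funext_iff
    rcases e.lt_or_eq with e | e
    · exact index_monotone c ((index_monotone q.comp).reflect_lt e).le
    · exact (h v w e).le
  by_cases hle : (⟨c, g⟩ : ColoredComposition G n) ≤ q
  · rw [if_pos (hiff.2 hle), if_pos hle]
    exact prod_eq_sign_div_deg (le_iff_index.1 hle).1
  · rw [if_neg fun h => hle (hiff.1 h), if_neg hle]

theorem blockType_cast_index {A : Type*} (c : Composition n) {k : ℕ} (h : c.length = k)
    (α : Fin k → A) : blockType (Fin.cast h ∘ c.index) α =
      (ColoredComposition.supp ⟨c, α ∘ Fin.cast h⟩).parts := by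
  subst h
  exact blockType_index c α

variable [Fintype G]

/-- The coefficient of the order of `{0, …, n - 1}` in the product with the chamber of the reversed
order: in a block only the functions without ties contribute. -/
theorem coeff_isotypic_mul_chamber_rev {k : ℕ} {x : Fin n → Fin k} (hx : Function.Surjective x)
    (α : Fin k → G →* ℂˣ) :
    (isotypic x α * δ (chamber ⟨Fin.revPerm, 1⟩)).coeff
        (ofFun x 1 * ofFun (fun v : Fin n => (v : ℕ)) 1) =
      ((Fintype.card G : ℂ) ^ k)⁻¹ *
        ∏ i, (-1) ^ (((Finset.univ.filter fun v => x v = i).image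
          fun v : Fin n => (v : ℕ)).card - 1) /
          (((Finset.univ.filter fun v => x v = i).image fun v : Fin n => (v : ℕ)).card : ℂ) := by
  classical
  have hmul : ∀ (g : Fin k → G) (h : Fin n → ℕ),
      ofFun x (g ∘ x) * ofFun h 1 * chamber ⟨Fin.revPerm, 1⟩ =
        ofFun x 1 * ofFun (fun v : Fin n => (v : ℕ)) 1 ↔
      g = 1 ∧ ∀ v w, x v = x w → (h v ≤ h w ↔ (v : ℕ) ≤ w) := by
    intro g h
    rw [ext_iff', and_comm]
    refine and_congr ⟨fun hc => ?_, ?_⟩ ⟨fun hle v w hvw => ?_, fun hle v w => ?_⟩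
    · funext i
      obtain ⟨v, rfl⟩ := hx i
      have := hc v
      change g (x v) * 1 * 1 = 1 * 1 at this
      simpa using this
    · rintro rfl v
      change (1 : G) * 1 * 1 = 1 * 1
      simp
    · have h1 := hle v w
      have h2 := hle w v
      change ((x v ≤ x w ∧ (x w ≤ x v → h v ≤ h w)) ∧
        ((x w ≤ x v ∧ (x v ≤ x w → h w ≤ h v)) → Fin.rev v ≤ Fin.rev w)) ↔
        (x v ≤ x w ∧ (x w ≤ x v → (v : ℕ) ≤ w)) at h1
      change ((x w ≤ x v ∧ (x v ≤ x w → h w ≤ h v)) ∧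
        ((x v ≤ x w ∧ (x w ≤ x v → h v ≤ h w)) → Fin.rev w ≤ Fin.rev v)) ↔
        (x w ≤ x v ∧ (x v ≤ x w → (w : ℕ) ≤ v)) at h2
      simp only [hvw, le_refl, true_and, forall_const, Fin.le_def, Fin.val_rev] at h1 h2
      omega
    · change ((x v ≤ x w ∧ (x w ≤ x v → h v ≤ h w)) ∧
        ((x w ≤ x v ∧ (x v ≤ x w → h w ≤ h v)) → Fin.rev v ≤ Fin.rev w)) ↔
        (x v ≤ x w ∧ (x w ≤ x v → (v : ℕ) ≤ w))
      rcases lt_trichotomy (x v) (x w) with hlt | heq | hgt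
      · simp [hlt.le, hlt.not_ge]
      · have hv := v.2
        have hw := w.2
        have h1 := hle v w heq
        have h2 := hle w v heq.symm
        simp only [heq, le_refl, true_and, forall_const, Fin.le_def, Fin.val_rev]
        omega
      · simp [hgt.not_ge]
  rw [isotypic, smul_mul_assoc, MonoidAlgebra.coeff_smul_apply, smul_eq_mul, Finset.sum_mul,
    MonoidAlgebra.coeff_sum, Finsupp.finsetSum_apply, Finset.sum_eq_single 1]
  · rw [inv_one, map_one, one_smul]
    congr 1
    rw [← prod_sum_linWeight_mul_choose _ (card_image_fiber_ne_zero hx _)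
      (card_image_fiber_le x _), ← sum_weight_mul_prod id, mul_eulerian, Finset.sum_mul,
      MonoidAlgebra.coeff_sum, Finsupp.finsetSum_apply]
    refine Finset.sum_congr rfl fun t _ => ?_
    rw [smul_mul_assoc, MonoidAlgebra.coeff_smul_apply, smul_eq_mul, Finset.sum_mul,
      MonoidAlgebra.coeff_sum, Finsupp.finsetSum_apply]
    congr 1
    have h := card_pattern_fiberwise x (fun v : Fin n => (v : ℕ)) t
    simp only [id_eq]
    rw [← Nat.cast_prod, ← h, Finset.card_filter, Nat.cast_sum]
    refine Finset.sum_congr rfl fun h _ => ?_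
    rw [← map_mul, ← map_mul, coeff_δ, Nat.cast_ite, Nat.cast_one, Nat.cast_zero]
    simp only [hmul, true_and]
    congr
  · intro g _ hg
    rw [smul_mul_assoc, MonoidAlgebra.coeff_smul_apply, mul_eulerian, Finset.sum_mul,
      MonoidAlgebra.coeff_sum, Finsupp.finsetSum_apply, Finset.sum_eq_zero, smul_zero]
    intro t _
    rw [smul_mul_assoc, MonoidAlgebra.coeff_smul_apply, Finset.sum_mul, MonoidAlgebra.coeff_sum,
      Finsupp.finsetSum_apply, Finset.sum_eq_zero, smul_zero]
    intro h _
    rw [← map_mul, ← map_mul, coeff_δ, if_neg fun e => hg ((hmul g h).1 e).1]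
  · exact fun h => absurd (Finset.mem_univ _) h

theorem isotypic_mul_chamber_rev_ne_zero {k : ℕ} {x : Fin n → Fin k} (hx : Function.Surjective x)
    (α : Fin k → G →* ℂˣ) : isotypic x α * δ (chamber ⟨Fin.revPerm, 1⟩) ≠ 0 := by
  intro h
  have h1 := coeff_isotypic_mul_chamber_rev hx α
  rw [h, MonoidAlgebra.coeff_zero, Finsupp.zero_apply] at h1
  refine mul_ne_zero (inv_ne_zero (card_pow_ne_zero G k)) (Finset.prod_ne_zero_iff.2 fun i _ => ?_)
    h1.symm
  refine div_ne_zero (pow_ne_zero _ (by norm_num)) ?_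
  exact_mod_cast card_image_fiber_ne_zero hx _ i

variable [Fintype (G →* ℂˣ)]

open scoped Classical in
/-- The ordered set partitions whose blocks are intervals, with blocks labelled by characters and by
elements of `G`, correspond to the pairs of colored compositions with the same underlying
composition. The other ordered set partitions do not contribute to the coefficients of the interval
faces. -/
theorem coeff_relIdem (lam : ColoredPartition (G →* ℂˣ) n) (q : ColoredComposition G n) :
    (relIdem lam).coeff (intervalFace q) =
      1 / ((Nat.card G : ℂ) ^ lam.parts.card * (lam.parts.card.factorial : ℂ)) *
        ∑ α : ColoredComposition (G →* ℂˣ) n with α.supp = lam,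
          ∑ p : ColoredComposition G n with p.comp = α.comp,
            starRingEnd ℂ (evalChar α p) * if p ≤ q then
              (-1 : ℂ) ^ ((q.comp.length : ℤ) - (p.comp.length : ℤ)) / (q.comp.deg p.comp : ℂ)
              else 0 := by
  have hL : (relIdem lam).coeff (intervalFace q) =
      1 / ((Nat.card G : ℂ) ^ lam.parts.card * (lam.parts.card.factorial : ℂ)) *
        ∑ T ∈ labelledPartitions lam ×ˢ (Finset.univ : Finset (Fin lam.parts.card → G)),
          pairing T.1.2 T.2⁻¹ *
            (δ (ofFun T.1.1 (T.2 ∘ T.1.1)) * eulerian T.1.1).coeff (intervalFace q) := by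
    rw [relIdem, MonoidAlgebra.coeff_smul_apply, MonoidAlgebra.coeff_sum, Finsupp.finsetSum_apply,
      Finset.sum_product, smul_eq_mul, one_div, mul_inv_rev, mul_assoc]
    congr 1
    rw [Finset.mul_sum]
    refine Finset.sum_congr rfl fun p _ => ?_
    rw [isotypic, MonoidAlgebra.coeff_smul_apply, MonoidAlgebra.coeff_sum, Finsupp.finsetSum_apply,
      smul_eq_mul, Nat.card_eq_fintype_card]
    congr 1
  rw [hL]
  congr 1
  symm
  refine (Finset.sum_sigma' _ _ _).trans ?_
  have hlen : ∀ α : ColoredComposition (G →* ℂˣ) n, α.supp = lam →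
      α.comp.length = lam.parts.card := by
    rintro α rfl
    exact (card_parts_supp α).symm
  have hmem : ∀ P : (_ : ColoredComposition (G →* ℂˣ) n) × ColoredComposition G n,
      P ∈ (Finset.univ.filter fun α : ColoredComposition (G →* ℂˣ) n => α.supp = lam).sigma
        (fun α => Finset.univ.filter fun p : ColoredComposition G n => p.comp = α.comp) ↔
      P.1.supp = lam ∧ P.2.comp = P.1.comp := by
    intro P
    simp
  refine Finset.sum_bij_ne_zero
    (fun P hP _ =>
      have h := (hmem P).1 hP
      ((Fin.cast (hlen _ h.1) ∘ P.1.comp.index, P.1.label ∘ Fin.cast (hlen _ h.1).symm),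
        P.2.label ∘ Fin.cast ((hlen _ h.1).symm.trans (congrArg Composition.length h.2.symm))))
    ?_ ?_ ?_ ?_
  · rintro ⟨⟨c, α⟩, p⟩ hP _
    have h := ((hmem _).1 hP).1
    refine Finset.mem_product.2 ⟨mem_labelledPartitions.2 ⟨?_, ?_⟩, Finset.mem_univ _⟩
    · exact (finCongr (hlen _ h)).surjective.comp (index_surjective c)
    · rw [blockType_cast_index]
      exact congrArg ColoredPartition.parts h
  · rintro ⟨⟨c, α⟩, ⟨c', g⟩⟩ hP _ ⟨⟨d, β⟩, ⟨d', g'⟩⟩ hP' _ e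
    obtain ⟨h, hc⟩ := (hmem _).1 hP
    obtain ⟨h', hd⟩ := (hmem _).1 hP'
    dsimp only at hc hd
    subst hc hd
    simp only [Prod.mk.injEq] at e
    obtain ⟨⟨e1, e2⟩, e3⟩ := e
    have hv : ∀ v, (c'.index v : ℕ) = d'.index v := fun v => congrArg Fin.val (congrFun e1 v)
    have hcd : c' = d' := by
      refine composition_eq_of_boundaries (Finset.Subset.antisymm ?_ ?_)
      · rw [boundaries_subset_iff]
        intro v w hvw
        rw [Fin.ext_iff, hv, hv, hvw]
      · rw [boundaries_subset_iff]
        intro v w hvw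
        rw [Fin.ext_iff, ← hv, ← hv, hvw]
    subst hcd
    have e2' : α = β := (finCongr (hlen _ h).symm).surjective.injective_comp_right e2
    have e3' : g = g' := (finCongr (hlen _ h).symm).surjective.injective_comp_right e3
    rw [e2', e3']
  · rintro ⟨⟨x, α⟩, g⟩ hT hne
    obtain ⟨hx, hxα⟩ := mem_labelledPartitions.1 (Finset.mem_product.1 hT).1
    dsimp only at hx hxα hne
    have hmono : Monotone x := by
      rw [coeff_intervalFace hx] at hne
      have := (ite_ne_right_iff.1 (right_ne_zero_of_mul hne)).1.2
      exact fun v w hvw => this v w (index_monotone _ hvw)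
    obtain ⟨c, hc, hxc⟩ := exists_composition hmono hx
    have hxc' : x = Fin.cast hc ∘ c.index := funext hxc
    subst hxc'
    have hP : (⟨⟨c, α ∘ Fin.cast hc⟩, ⟨c, g ∘ Fin.cast hc⟩⟩ :
        (_ : ColoredComposition (G →* ℂˣ) n) × ColoredComposition G n) ∈
        (Finset.univ.filter fun α : ColoredComposition (G →* ℂˣ) n => α.supp = lam).sigma
          (fun α => Finset.univ.filter fun p : ColoredComposition G n => p.comp = α.comp) := by
      rw [hmem]
      exact ⟨ColoredPartition.ext ((blockType_cast_index c hc α).symm.trans hxα), rfl⟩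
    refine ⟨_, hP, ?_, rfl⟩
    refine ne_of_eq_of_ne ?_ hne
    exact (pairing_mul_coeff_intervalFace c (α ∘ Fin.cast hc) (g ∘ Fin.cast hc) q hc).symm
  · rintro ⟨⟨c, α⟩, ⟨c', g⟩⟩ hP _
    obtain ⟨h, hc⟩ := (hmem _).1 hP
    dsimp only at hc
    subst hc
    exact (pairing_mul_coeff_intervalFace c' α g q (hlen _ h)).symm

theorem toGroupAlg_relIdem (lam : ColoredPartition (G →* ℂˣ) n) :
    toGroupAlg (relIdem lam) = idem lam := by
  classical
  rw [toGroupAlg_apply, idem]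
  simp only [coeff_relIdem, mul_smul, ← Finset.smul_sum, Finset.sum_smul]
  congr 1
  rw [Finset.sum_comm]
  refine Finset.sum_congr (by congr) fun α _ => ?_
  rw [Finset.sum_comm]
  refine Finset.sum_congr (by congr) fun p _ => ?_
  rw [← Finset.smul_sum, Finset.sum_filter]
  congr 1
  refine Finset.sum_congr rfl fun q _ => ?_
  rw [ite_smul, zero_smul]

/-- Otherwise `relIdem lam` would annihilate all chambers, and hence so would every `isotypic x α`
of type `lam`. -/
theorem toGroupAlg_relIdem_ne_zero (lam : ColoredPartition (G →* ℂˣ) n) :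
    toGroupAlg (relIdem lam) ≠ 0 := by
  classical
  intro h
  obtain ⟨⟨c, α⟩, rfl⟩ := ColoredComposition.supp_surjective lam
  refine isotypic_mul_chamber_rev_ne_zero (index_surjective c) α ?_
  have hmem := relIdem_mem_faceInvariants (ColoredComposition.supp ⟨c, α⟩)
  have h1 := toChambers_mul hmem (toChambers_toGroupAlg hmem)
    (MonoidAlgebra.of ℂ (ColoredPerm G n) ⟨Fin.revPerm, 1⟩)
  rw [h, mul_zero, map_zero, toChambers_of] at h1
  have h2 := isotypic_mul_relIdem (index_surjective c) α (ColoredComposition.supp ⟨c, α⟩)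
  rw [if_pos (blockType_index c α)] at h2
  rw [← h2, mul_assoc, ← h1, mul_zero]

/-! ### The complete system of primitive orthogonal idempotents -/

/-- The idempotent attached to `lam`, as an element of the Mantaci–Reutenauer algebra. -/
noncomputable def mrIdem (lam : ColoredPartition (G →* ℂˣ) n) : mrSubalgebra G n :=
  ⟨toGroupAlg (relIdem lam), relIdem lam, relIdem_mem_faceInvariants lam, rfl⟩

open scoped Classical in
theorem mrIdem_mul_mrIdem (lam mu : ColoredPartition (G →* ℂˣ) n) :
    mrIdem lam * mrIdem mu = if lam = mu then mrIdem lam else 0 := by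
  refine Subtype.ext ?_
  change toGroupAlg _ * toGroupAlg _ = _
  rw [toGroupAlg_mul (relIdem_mem_faceInvariants _) (relIdem_mem_faceInvariants _),
    relIdem_mul_relIdem]
  by_cases h : lam = mu
  · rw [if_pos h.symm, if_pos h, h]
    rfl
  · rw [if_neg (Ne.symm h), if_neg h, map_zero]
    rfl

theorem sum_mrIdem : ∑ lam : ColoredPartition (G →* ℂˣ) n, mrIdem lam = 1 := by
  refine Subtype.ext ?_
  rw [AddSubmonoidClass.coe_finsetSum]
  change ∑ lam, toGroupAlg _ = 1
  rw [← map_sum, sum_relIdem, toGroupAlg_one]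

theorem isIdempotentElem_mrIdem (lam : ColoredPartition (G →* ℂˣ) n) :
    IsIdempotentElem (mrIdem lam) := by
  rw [IsIdempotentElem, mrIdem_mul_mrIdem, if_pos rfl]

theorem exists_mrIdem_mul_mul_mrIdem (lam : ColoredPartition (G →* ℂˣ) n) (e : mrSubalgebra G n) :
    ∃ c : ℂ, mrIdem lam * e * mrIdem lam = c • mrIdem lam := by
  obtain ⟨A, a, ha, rfl⟩ := e
  obtain ⟨c, hc⟩ := exists_smul_of_corner ha lam
  have hmem := relIdem_mem_faceInvariants lam
  refine ⟨c, Subtype.ext ?_⟩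
  change toGroupAlg _ * toGroupAlg _ * toGroupAlg _ = c • toGroupAlg _
  rw [toGroupAlg_mul hmem ha, toGroupAlg_mul (Subalgebra.mul_mem _ ha hmem) hmem, hc, map_smul]

theorem isPrimitiveIdempotent_mrIdem (lam : ColoredPartition (G →* ℂˣ) n) :
    IsPrimitiveIdempotent (mrIdem lam) := by
  have hne : mrIdem lam ≠ 0 := fun h => toGroupAlg_relIdem_ne_zero lam (congrArg Subtype.val h)
  refine ⟨isIdempotentElem_mrIdem lam, hne, fun e₁ e₂ h₁ h₂ h₁₂ h₂₁ hsum => ?_⟩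
  have hcorner : mrIdem lam * e₁ * mrIdem lam = e₁ := by
    rw [hsum, add_mul, h₂₁, add_zero, h₁.eq, mul_add, h₁.eq, h₁₂, add_zero]
  obtain ⟨c, hc⟩ := exists_mrIdem_mul_mul_mrIdem lam e₁
  rw [hcorner] at hc
  have hcc : IsIdempotentElem c := by
    have h := h₁.eq
    rw [hc, smul_mul_smul_comm, (isIdempotentElem_mrIdem lam).eq] at h
    exact smul_left_injective ℂ hne h
  rcases IsIdempotentElem.iff_eq_zero_or_one.1 hcc with h0 | h1
  · left
    rw [hc, h0, zero_smul]
  · right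
    rw [hc, h1, one_smul] at hsum
    exact left_eq_add.1 hsum

end

end MantaciReutenauer

theorem theorem7p3 {G : Type*} [CommGroup G] [Finite G] (n : ℕ) (hn : 0 < n) :
    ∃ MR : Subalgebra ℂ (MantaciReutenauer.GroupAlg G n),
      Subalgebra.toSubmodule MR = MantaciReutenauer.mrSubmodule G n ∧
      ∃ f : ColoredPartition (G →* ℂˣ) n → MR,
        (∀ lam, (f lam : MantaciReutenauer.GroupAlg G n) = MantaciReutenauer.idem lam) ∧
        IsCSoPOI f := by
  have := Fintype.ofFinite G
  have := Fintype.ofFinite (G →* ℂˣ)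
  refine ⟨MantaciReutenauer.mrSubalgebra G n, MantaciReutenauer.toSubmodule_mrSubalgebra,
    MantaciReutenauer.mrIdem, MantaciReutenauer.toGroupAlg_relIdem,
    ⟨⟨MantaciReutenauer.isIdempotentElem_mrIdem, fun lam mu hne => ?_⟩,
      MantaciReutenauer.sum_mrIdem⟩, MantaciReutenauer.isPrimitiveIdempotent_mrIdem⟩
  classical
  change MantaciReutenauer.mrIdem lam * MantaciReutenauer.mrIdem mu = 0
  rw [MantaciReutenauer.mrIdem_mul_mrIdem, if_neg hne]
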